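/- Let $s\in\{0,\tfrac12,1,\tfrac32,\dots\}$, let $L_1,L_2,L_3$ be the angular momentum operators of a spin-$s$ system on $\mathcal H=\mathbb C^{2s+1}$, in their standard matrix form in an orthonormal basis $|m\rangle$, $m=s,s-1,\dots,-s$ ($L_3|m\rangle=m|m\rangle$ and $(L_1\pm iL_2)|m\rangle=\sqrt{s(s+1)-m(m\pm1)}\,|m\pm1\rangle$), and let $1\le\alpha<\infty$. For $g\in SU(2)$ let $U_g$ be the operator of $g$ in the spin-$s$ representation and $R_g\in SO(3)$ the corresponding rotation of $\mathbb R^3$. An observable on a measurable space $\Omega$ is a positive operator valued measure $F$ on $\Omega$ with values in the operators on $\mathcal H$ and $F(\Omega)=1$; its output distribution in a state (density operator) $\rho$ is $F_\rho(S)=\operatorname{tr}(\rho F(S))$. For a unit vector $e\in\mathbb R^3$, let $E^e$ be the spectral measure of $e\cdot L=\sum_i e_iL_i$, and for an observable $F$ on $\mathbb R^3$ (with its Borel sets) let $F^e$ be its marginal, the observable on $\mathbb R$ given by $F^e(S)=F(\{\eta: e\cdot\eta\in S\})$. For probability measures on $\mathbb R$ let $D_\alpha(\mu,\delta_x)=\big(\int|y-x|^\alpha\,\mu(dy)\big)^{1/\alpha}$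 and $D_\alpha(\mu,\nu)=\inf_\gamma\big(\int|x-y|^\alpha\,\gamma(dx\,dy)\big)^{1/\alpha}$, the infimum being over all couplings $\gamma$ of $\mu$ and $\nu$ (values in $[0,\infty]$). For observables $F,E$ on $\mathbb R$ define the metric error $D_\alpha(F,E)=\sup_\rho D_\alpha(F_\rho,E_\rho)$ and the calibration error $$\Delta^c_\alpha(F,E)=\lim_{\varepsilon\to0^+}\ \sup\{D_\alpha(F_\rho,\delta_x)\,:\,x\in\mathbb R,\ \rho\text{ a state},\ D_\alpha(E_\rho,\delta_x)\le\varepsilon\}.$$ For an observable $F$ on $\mathbb R^3$ put $$D_{\max}(F)=\sup_{|e|=1}D_\alpha(F^e,E^e),\qquad \Delta_{\max}(F)=\sup_{|e|=1}\Delta^c_\alpha(F^e,E^e),$$ both in $[0,\infty]$. Let $(T_gF)(S)=U_gF(R_g^{-1}S)U_g^*$, and call $F$ covariant if $U_g^*F(S)U_g=F(R_g^{-1}S)$ for all $g\in SU(2)$ and all Borel sets $S$. Then: 1. $D_{\max}(T_gF)=D_{\max}(F)$ and $\Delta_{\max}(T_gF)=\Delta_{\max}(F)$ for all $g\in SU(2)$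 and all observables $F$ on $\mathbb R^3$, and $F\mapsto D_{\max}(F)^\alpha$ and $F\mapsto\Delta_{\max}(F)^\alpha$ are convex on the set of observables on $\mathbb R^3$. 2. $\inf_FD_{\max}(F)=\inf_{F\text{ covariant}}D_{\max}(F)$ and $\inf_F\Delta_{\max}(F)=\inf_{F\text{ covariant}}\Delta_{\max}(F)$, where $F$ ranges over all observables on $\mathbb R^3$, respectively over the covariant ones. -/

import Mathlib

open MeasureTheory Matrix Polynomial
open scoped ENNReal NNReal Topology ComplexOrder

noncomputable section

namespace AngularMomentum

/-! ### Angular momentum operators of a system of spin `s = N / 2` -/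

/-- Operators on the `(2s+1)`-dimensional Hilbert space `ℂ^(N+1)`, `s = N / 2`. The basis vector
with index `k` is the vector `|m⟩` with magnetic quantum number `m = s - k`. -/
abbrev Op (N : ℕ) := Matrix (Fin (N + 1)) (Fin (N + 1)) ℂ

/-- Three-dimensional Euclidean space. -/
abbrev E3 := EuclideanSpace ℝ (Fin 3)

/-- The magnetic quantum number `m = s - k`. -/
def magnetic (N : ℕ) (k : Fin (N + 1)) : ℝ := (N : ℝ) / 2 - (k : ℕ)

/-- The raising operator, `L₊ |m⟩ = √(s(s+1) - m(m+1)) |m+1⟩`. -/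
def Lplus (N : ℕ) : Op N := Matrix.of fun j k =>
  if (j : ℕ) + 1 = k then
    ((√((N : ℝ) / 2 * ((N : ℝ) / 2 + 1) - magnetic N k * (magnetic N k + 1)) : ℝ) : ℂ) else 0

/-- The angular momentum components `L₁ = (L₊ + L₋)/2`, `L₂ = (L₊ - L₋)/(2i)`, `L₃`, where `L₋` is
the adjoint of `L₊` and `L₃ |m⟩ = m |m⟩`. -/
def L (N : ℕ) : Fin 3 → Op N :=
  ![(1 / 2 : ℂ) • (Lplus N + (Lplus N)ᴴ),
    (1 / (2 * Complex.I)) • (Lplus N - (Lplus N)ᴴ),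
    diagonal fun k => (magnetic N k : ℂ)]

/-- The component `e · L` of angular momentum. -/
def LComp (N : ℕ) (e : E3) : Op N := ∑ i, (e i : ℂ) • L N i

lemma L_isHermitian (N : ℕ) (i : Fin 3) : (L N i).IsHermitian := by
  fin_cases i
  · simp [L, Matrix.IsHermitian, add_comm]
  · ext j k
    simp [L, Matrix.conjTranspose_apply]
    ring
  · refine isHermitian_diagonal_of_self_adjoint _ ?_
    ext k
    simp

lemma LComp_isHermitian (N : ℕ) (e : E3) : (LComp N e).IsHermitian := by
  unfold LComp Matrix.IsHermitian
  rw [conjTranspose_sum]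
  refine Finset.sum_congr rfl fun i _ => ?_
  rw [conjTranspose_smul, (L_isHermitian N i).eq]
  simp

/-! ### The spin-`N/2` representation of `SU(2)` -/

/-- `SU(2)`, the double cover of the rotation group. -/
abbrev SU2 := specialUnitaryGroup (Fin 2) ℂ

/-- For `g = !![a, b; c, d]`, the coefficient of `x ^ (N - j) * y ^ j` in
`(a x + c y) ^ (N - k) * (b x + d y) ^ k` (written with `x = 1`, `y = X`), that is, the matrix
elements of the action of `g` on homogeneous polynomials of degree `N` in two variables. -/
def spinCoeff (N : ℕ) (g : Matrix (Fin 2) (Fin 2) ℂ) (j k : ℕ) : ℂ :=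
  (((C (g 0 0) + C (g 1 0) * X) ^ (N - k) * (C (g 0 1) + C (g 1 1) * X) ^ k : ℂ[X])).coeff j

/-- The matrix of `g` in the spin-`N/2` representation, with respect to the orthonormal basis
`|m⟩ = x ^ (s + m) * y ^ (s - m) / √((s + m)! (s - m)!)`, `m = s - k`, `s = N / 2`. -/
def spinMatrix (N : ℕ) (g : Matrix (Fin 2) (Fin 2) ℂ) : Matrix (Fin (N + 1)) (Fin (N + 1)) ℂ :=
  Matrix.of fun j k => ((√(N.choose k) / √(N.choose j) : ℝ) : ℂ) * spinCoeff N g j k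

lemma linear_homogenize (p q : ℂ) (r : ℂ[X]) (A B : ℂ[X]) (m : ℕ) (hr : r.natDegree ≤ m) :
    ∑ l ∈ Finset.range (m + 1 + 1), C (((C p + C q * X) * r).coeff l) * (A ^ (m + 1 - l) * B ^ l)
      = (C p * A + C q * B) * ∑ l ∈ Finset.range (m + 1), C (r.coeff l) * (A ^ (m - l) * B ^ l) := by
  have h0 : r.coeff (m + 1) = 0 := coeff_eq_zero_of_natDegree_lt (by omega)
  have e1 : ∑ l ∈ Finset.range (m + 1 + 1), C (((C p + C q * X) * r).coeff l) * (A ^ (m + 1 - l) * B ^ l)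
      = ∑ l ∈ Finset.range (m + 1 + 1), C (p * r.coeff l) * (A ^ (m + 1 - l) * B ^ l) +
        ∑ l ∈ Finset.range (m + 1 + 1), C (q * (X * r).coeff l) * (A ^ (m + 1 - l) * B ^ l) := by
    rw [← Finset.sum_add_distrib]
    refine Finset.sum_congr rfl fun l _ => ?_
    rw [add_mul, mul_assoc, coeff_add, coeff_C_mul, coeff_C_mul, C_add, add_mul]
  have e2 := Finset.sum_range_succ'
    (fun l => C (q * (X * r).coeff l) * (A ^ (m + 1 - l) * B ^ l)) (m + 1)
  rw [e1, e2, Finset.sum_range_succ]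
  simp only [h0, coeff_X_mul, coeff_X_mul_zero, mul_zero, C_0, zero_mul, add_zero]
  rw [add_mul, Finset.mul_sum, Finset.mul_sum]
  refine congrArg₂ (· + ·) (Finset.sum_congr rfl fun l hl => ?_)
    (Finset.sum_congr rfl fun l _ => ?_)
  · have : m + 1 - l = (m - l) + 1 := by have := Finset.mem_range.1 hl; omega
    rw [this, C_mul, pow_succ]; ring
  · rw [Nat.add_sub_add_right, C_mul, pow_succ]; ring

lemma natDegree_linear_pow_mul_le (a b c d : ℂ) (u v : ℕ) :
    ((C a + C b * X) ^ u * (C c + C d * X) ^ v : ℂ[X]).natDegree ≤ u + v := by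
  have h : ∀ x y : ℂ, (C x + C y * X : ℂ[X]).natDegree ≤ 1 := fun x y => by
    rw [add_comm]; exact natDegree_linear_le
  refine natDegree_mul_le.trans (add_le_add ?_ ?_)
  · exact (natDegree_pow_le_of_le u (h a b)).trans (by omega)
  · exact (natDegree_pow_le_of_le v (h c d)).trans (by omega)

lemma linear_pow_homogenize (a b c d : ℂ) (A B : ℂ[X]) (u v : ℕ) :
    ∑ l ∈ Finset.range (u + v + 1),
        C (((C a + C b * X) ^ u * (C c + C d * X) ^ v : ℂ[X]).coeff l) * (A ^ (u + v - l) * B ^ l)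
      = (C a * A + C b * B) ^ u * (C c * A + C d * B) ^ v := by
  induction u with
  | zero =>
    induction v with
    | zero => simp
    | succ v ih =>
      have h := linear_homogenize c d ((C a + C b * X) ^ 0 * (C c + C d * X) ^ v) A B (0 + v)
        (natDegree_linear_pow_mul_le a b c d 0 v)
      rw [ih] at h
      rw [show (C a + C b * X) ^ 0 * (C c + C d * X) ^ (v + 1)
        = (C c + C d * X) * ((C a + C b * X) ^ 0 * (C c + C d * X) ^ v) by ring]
      rw [← add_assoc, h]; ring
  | succ u ih =>
      have h := linear_homogenize a b ((C a + C b * X) ^ u * (C c + C d * X) ^ v) A B (u + v)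
        (natDegree_linear_pow_mul_le a b c d u v)
      rw [ih] at h
      rw [show (C a + C b * X) ^ (u + 1) * (C c + C d * X) ^ v
        = (C a + C b * X) * ((C a + C b * X) ^ u * (C c + C d * X) ^ v) by ring]
      rw [show u + 1 + v = u + v + 1 by ring, h]; ring

lemma spinCoeff_mul (N : ℕ) (g h : Matrix (Fin 2) (Fin 2) ℂ) (j k : ℕ) (hk : k ≤ N) :
    ∑ l ∈ Finset.range (N + 1), spinCoeff N g j l * spinCoeff N h l k = spinCoeff N (g * h) j k := by
  have key := linear_pow_homogenize (h 0 0) (h 1 0) (h 0 1) (h 1 1)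
    (C (g 0 0) + C (g 1 0) * X) (C (g 0 1) + C (g 1 1) * X) (N - k) k
  rw [Nat.sub_add_cancel hk] at key
  have := congrArg (fun p => coeff p j) key
  simp only [finsetSum_coeff, coeff_C_mul] at this
  unfold spinCoeff
  simp only [Matrix.mul_apply, Fin.sum_univ_two]
  rw [Finset.sum_congr rfl (fun l _ => mul_comm _ _), this]
  congr 3 <;> simp only [C_add, C_mul] <;> ring

lemma coeff_coeff_swap (p : ℂ[X][X]) (i j : ℕ) :
    ((Bivariate.swap p).coeff i).coeff j = (p.coeff j).coeff i := by
  induction p using Polynomial.induction_on' with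
  | add p q hp hq => simp only [map_add, coeff_add, hp, hq]
  | monomial n r =>
    induction r using Polynomial.induction_on' with
    | add r t hr ht => simp only [map_add, coeff_add, hr, ht]
    | monomial m c =>
      rw [Bivariate.swap_monomial_monomial]
      simp only [coeff_monomial]
      split_ifs <;> simp [coeff_monomial, *]

lemma coeff_linear_pow (P Q : ℂ[X]) (N k : ℕ) :
    ((C P + C Q * X : ℂ[X][X]) ^ N).coeff k = C (N.choose k : ℂ) * (P ^ (N - k) * Q ^ k) := by
  have h : (C P + C Q * X : ℂ[X][X]) ^ N = ∑ m ∈ Finset.range (N + 1),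
      C (C (N.choose m : ℂ) * (P ^ (N - m) * Q ^ m)) * X ^ m := by
    rw [add_comm, add_pow]
    refine Finset.sum_congr rfl fun m _ => ?_
    simp only [C_mul, C_pow, mul_pow, map_natCast]
    ring
  rw [h, finsetSum_coeff]
  simp only [coeff_C_mul_X_pow]
  rw [Finset.sum_ite_eq]
  split_ifs with hk
  · rfl
  · rw [Nat.choose_eq_zero_of_lt (by simpa using hk)]; simp

lemma spinCoeff_transpose (N : ℕ) (g : Matrix (Fin 2) (Fin 2) ℂ) (j k : ℕ) :
    (N.choose k : ℂ) * spinCoeff N g j k = N.choose j * spinCoeff N gᵀ k j := by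
  have h := coeff_coeff_swap
    ((C (C (g 0 0) + C (g 1 0) * X) + C (C (g 0 1) + C (g 1 1) * X) * X : ℂ[X][X]) ^ N) j k
  have e : Bivariate.swap
      (C (C (g 0 0) + C (g 1 0) * X) + C (C (g 0 1) + C (g 1 1) * X) * X : ℂ[X][X])
      = C (C (g 0 0) + C (g 0 1) * X) + C (C (g 1 0) + C (g 1 1) * X) * X := by
    simp only [map_add, map_mul, Bivariate.swap_C_C, Bivariate.swap_X, Bivariate.swap_Y]
    ring
  rw [map_pow, e, coeff_linear_pow, coeff_linear_pow, coeff_C_mul, coeff_C_mul] at h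
  exact h.symm

lemma spinMatrix_mul (N : ℕ) (g h : Matrix (Fin 2) (Fin 2) ℂ) :
    spinMatrix N (g * h) = spinMatrix N g * spinMatrix N h := by
  ext j k
  have hpos : ∀ l : Fin (N + 1), ((√(N.choose l) : ℝ) : ℂ) ≠ 0 := fun l => by
    have : 0 < N.choose l := Nat.choose_pos (Nat.lt_succ_iff.1 l.2)
    exact_mod_cast (Real.sqrt_pos.2 (by exact_mod_cast this)).ne'
  rw [Matrix.mul_apply]
  simp only [spinMatrix, Matrix.of_apply]
  rw [← spinCoeff_mul N g h j k (Nat.lt_succ_iff.1 k.2), Finset.sum_range, Finset.mul_sum]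
  refine Finset.sum_congr rfl fun l _ => ?_
  have := hpos l; have := hpos j
  push_cast
  field_simp

lemma spinMatrix_one (N : ℕ) : spinMatrix N 1 = 1 := by
  ext j k
  have hpos : ((√(N.choose k) : ℝ) : ℂ) ≠ 0 := by
    have : 0 < N.choose k := Nat.choose_pos (Nat.lt_succ_iff.1 k.2)
    exact_mod_cast (Real.sqrt_pos.2 (by exact_mod_cast this)).ne'
  simp only [spinMatrix, spinCoeff, Matrix.of_apply, Matrix.one_apply]
  by_cases h : j = k
  · subst h; simp [hpos]
  · have : (j : ℕ) ≠ k := fun h' => h (Fin.ext h')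
    simp [h, coeff_X_pow, this]

lemma spinCoeff_star (N : ℕ) (g : Matrix (Fin 2) (Fin 2) ℂ) (j k : ℕ) :
    star (spinCoeff N g j k) = spinCoeff N (g.map star) j k := by
  simp only [spinCoeff]
  rw [← starRingEnd_apply, ← coeff_map]
  simp [Polynomial.map_mul, Polynomial.map_pow]

lemma spinMatrix_conjTranspose (N : ℕ) (g : Matrix (Fin 2) (Fin 2) ℂ) :
    (spinMatrix N g)ᴴ = spinMatrix N gᴴ := by
  ext j k
  have hpos : ∀ l : Fin (N + 1), ((√(N.choose l) : ℝ) : ℂ) ≠ 0 := fun l => by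
    have : 0 < N.choose l := Nat.choose_pos (Nat.lt_succ_iff.1 l.2)
    exact_mod_cast (Real.sqrt_pos.2 (by exact_mod_cast this)).ne'
  have hsq : ∀ l : Fin (N + 1), ((√(N.choose l) : ℝ) : ℂ) ^ 2 = N.choose l := fun l => by
    rw [← Complex.ofReal_pow, Real.sq_sqrt (by positivity)]; simp
  have h := spinCoeff_transpose N (g.map star) k j
  have hj := hpos j; have hk := hpos k
  rw [← hsq, ← hsq] at h
  simp only [spinMatrix, Matrix.conjTranspose_apply, Matrix.of_apply, star_mul', spinCoeff_star]
  rw [show (g.map star)ᵀ = gᴴ from rfl] at h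
  have hr : ∀ x : ℝ, star (x : ℂ) = x := Complex.conj_ofReal
  rw [hr]
  push_cast
  field_simp
  exact h

/-- The spin-`N/2` representation `g ↦ U_g` of `SU(2)` by unitary operators. -/
def spinRep (N : ℕ) : SU2 →* unitaryGroup (Fin (N + 1)) ℂ where
  toFun g := ⟨spinMatrix N g.1, mem_unitaryGroup_iff.2 (by
    rw [star_eq_conjTranspose, spinMatrix_conjTranspose, ← spinMatrix_mul,
      ← star_eq_conjTranspose, mem_unitaryGroup_iff.1 g.2.1, spinMatrix_one])⟩
  map_one' := Subtype.ext (spinMatrix_one N)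
  map_mul' g h := Subtype.ext (spinMatrix_mul N g.1 h.1)

/-! ### The action of `SU(2)` on three-dimensional space -/

/-- The Pauli matrices. -/
def pauli : Fin 3 → Matrix (Fin 2) (Fin 2) ℂ :=
  ![!![0, 1; 1, 0], !![0, -Complex.I; Complex.I, 0], !![1, 0; 0, -1]]

/-- The rotation matrix `R_g` of `g ∈ SU(2)`, given by `g (x · σ) g* = (R_g x) · σ`, that is, by
`(R_g)ᵢⱼ = tr (σᵢ g σⱼ g*) / 2`. -/
def rotMatrix (g : SU2) : Matrix (Fin 3) (Fin 3) ℝ :=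
  Matrix.of fun i j => (trace (pauli i * g.1 * pauli j * g.1ᴴ)).re / 2

/-- The action `x ↦ R_g x` of `SU(2)` on three-dimensional space by rotations. -/
def rot (g : SU2) : E3 →L[ℝ] E3 := toEuclideanCLM (𝕜 := ℝ) (rotMatrix g)

/-! ### Observables and states -/

/-- An observable with outcome space `Ω`: a normalized positive operator valued measure. -/
structure Observable (N : ℕ) (Ω : Type*) [MeasurableSpace Ω] where
  toVectorMeasure : VectorMeasure Ω (Op N)
  posSemidef : ∀ S, (toVectorMeasure S).PosSemidef
  normalized : toVectorMeasure Set.univ = 1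

/-- A state (density operator). -/
structure State (N : ℕ) where
  toOp : Op N
  posSemidef : toOp.PosSemidef
  trace_eq_one : trace toOp = 1

lemma re_trace_mul_nonneg {N : ℕ} {A B : Op N} (hA : A.PosSemidef) (hB : B.PosSemidef) :
    0 ≤ (trace (A * B)).re := by
  obtain ⟨M, rfl⟩ : ∃ M : Op N, A = Mᴴ * M := by
    open scoped MatrixOrder in
    exact CStarAlgebra.nonneg_iff_eq_star_mul_self.mp hA.nonneg
  rw [Matrix.mul_assoc, trace_mul_comm]
  exact (Complex.le_def.1 (hB.mul_mul_conjTranspose_same M).trace_nonneg).1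

lemma measurable_inner_left (e : E3) : Measurable fun η : E3 => inner ℝ e η :=
  (continuous_const.inner continuous_id).measurable

namespace Observable

variable {N : ℕ} {Ω : Type*} [MeasurableSpace Ω]

/-- The output distribution `F_ρ(S) = tr (ρ F(S))` of the observable `F` in the state `ρ`. -/
def dist (F : Observable N Ω) (ρ : State N) : Measure Ω :=
  Measure.ofMeasurable (fun S _ => ENNReal.ofReal (trace (ρ.toOp * F.toVectorMeasure S)).re)
    (by simp)
    (by
      intro f hf hd
      have h1 : HasSum (fun i => F.toVectorMeasure (f i)) (F.toVectorMeasure (⋃ i, f i)) :=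
        F.toVectorMeasure.m_iUnion hf hd
      have hc : Continuous fun A : Op N => (trace (ρ.toOp * A)).re :=
        Complex.continuous_re.comp (Continuous.matrix_trace (continuous_const.matrix_mul continuous_id))
      let φ : Op N →+ ℝ :=
        { toFun := fun A => (trace (ρ.toOp * A)).re
          map_zero' := by simp
          map_add' := fun A B => by simp [Matrix.mul_add] }
      have h2 := h1.map φ hc
      change ENNReal.ofReal (φ (F.toVectorMeasure (⋃ i, f i))) = _
      rw [← h2.tsum_eq, ENNReal.ofReal_tsum_of_nonneg _ h2.summable]
      · rfl
      · exact fun i => re_trace_mul_nonneg ρ.posSemidef (F.posSemidef _))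

lemma dist_apply (F : Observable N Ω) (ρ : State N) {S : Set Ω} (hS : MeasurableSet S) :
    F.dist ρ S = ENNReal.ofReal (trace (ρ.toOp * F.toVectorMeasure S)).re :=
  Measure.ofMeasurable_apply S hS

/-- The convex combination `a F + b G` of two observables. -/
def mix (a b : ℝ≥0) (hab : a + b = 1) (F G : Observable N Ω) : Observable N Ω where
  toVectorMeasure := (a : ℝ) • F.toVectorMeasure + (b : ℝ) • G.toVectorMeasure
  posSemidef S := by
    have := ((F.posSemidef S).smul a.2).add ((G.posSemidef S).smul b.2)
    exact this
  normalized := by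
    have h : (a : ℝ) + b = 1 := by exact_mod_cast hab
    change (a : ℝ) • F.toVectorMeasure Set.univ + (b : ℝ) • G.toVectorMeasure Set.univ = 1
    rw [F.normalized, G.normalized, ← add_smul, h, one_smul]

/-- The marginal `F^e` of a vector valued observable: the outcome `e · η` is computed from the
outcome `η` of `F`. -/
def marginal (e : E3) (F : Observable N E3) : Observable N ℝ where
  toVectorMeasure := F.toVectorMeasure.map fun η => inner ℝ e η
  posSemidef S := by
    by_cases hS : MeasurableSet S
    · rw [VectorMeasure.map_apply _ (measurable_inner_left e) hS]
      exact F.posSemidef _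
    · rw [VectorMeasure.not_measurable _ hS]
      exact PosSemidef.zero
  normalized := by
    rw [VectorMeasure.map_apply _ (measurable_inner_left e) MeasurableSet.univ]
    exact F.normalized

/-- Conjugation `A ↦ U A U*`. -/
def conj (U : unitaryGroup (Fin (N + 1)) ℂ) : Op N →+ Op N where
  toFun A := U.1 * A * U.1ᴴ
  map_zero' := by simp
  map_add' A B := by simp [Matrix.mul_add, Matrix.add_mul]

lemma continuous_conj (U : unitaryGroup (Fin (N + 1)) ℂ) : Continuous (conj U) :=
  (continuous_const.matrix_mul continuous_id).matrix_mul continuous_const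

/-- The action of rotations on observables, `(T_g F)(S) = U_g F(g⁻¹ S) U_g*`, where
`g⁻¹ S = {x | R_g x ∈ S}`. -/
def T (g : SU2) (F : Observable N E3) : Observable N E3 where
  toVectorMeasure := (F.toVectorMeasure.map (rot g)).mapRange (conj (spinRep N g)) (continuous_conj _)
  posSemidef S := by
    have h : ((F.toVectorMeasure.map (rot g)) S).PosSemidef := by
      by_cases hS : MeasurableSet S
      · rw [VectorMeasure.map_apply _ (rot g).continuous.measurable hS]
        exact F.posSemidef _
      · rw [VectorMeasure.not_measurable _ hS]
        exact PosSemidef.zero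
    exact h.mul_mul_conjTranspose_same (spinRep N g).1
  normalized := by
    change (spinRep N g).1 * (F.toVectorMeasure.map (rot g)) Set.univ * (spinRep N g).1ᴴ = 1
    rw [VectorMeasure.map_apply _ (rot g).continuous.measurable MeasurableSet.univ,
      Set.preimage_univ, F.normalized, Matrix.mul_one, ← star_eq_conjTranspose]
    exact mem_unitaryGroup_iff.1 (spinRep N g).2

lemma T_apply (g : SU2) (F : Observable N E3) {S : Set E3} (hS : MeasurableSet S) :
    (T g F).toVectorMeasure S =
      (spinRep N g).1 * F.toVectorMeasure (rot g ⁻¹' S) * (spinRep N g).1ᴴ := by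
  change (spinRep N g).1 * (F.toVectorMeasure.map (rot g)) S * (spinRep N g).1ᴴ = _
  rw [VectorMeasure.map_apply _ (rot g).continuous.measurable hS]

/-- Rotation covariant observables: `U_g* F(S) U_g = F(g⁻¹ S)` for all `g` and all Borel sets. -/
def IsCovariant (F : Observable N E3) : Prop :=
  ∀ (g : SU2) (S : Set E3), MeasurableSet S →
    (spinRep N g).1ᴴ * F.toVectorMeasure S * (spinRep N g).1 = F.toVectorMeasure (rot g ⁻¹' S)

/-- The spectral measure of a Hermitian matrix `A`: the sum over an orthonormal basis of
eigenvectors `v i` with eigenvalues `a i` of the point measures at `a i` with value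
`|v i⟩⟨v i|`. -/
def spectral (A : Op N) (hA : A.IsHermitian) : Observable N ℝ where
  toVectorMeasure := ∑ i, VectorMeasure.dirac (hA.eigenvalues i)
    (vecMulVec (hA.eigenvectorBasis i) (star (hA.eigenvectorBasis i : Fin (N + 1) → ℂ)))
  posSemidef S := by
    rw [FunLike.coe_sum, Finset.sum_apply]
    refine posSemidef_sum _ fun i _ => ?_
    by_cases hi : hA.eigenvalues i ∈ S
    · by_cases hS : MeasurableSet S
      · rw [VectorMeasure.dirac_apply_of_mem hS hi]
        exact posSemidef_vecMulVec_self_star _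
      · rw [VectorMeasure.not_measurable _ hS]
        exact PosSemidef.zero
    · rw [VectorMeasure.dirac_apply_of_notMem hi]
      exact PosSemidef.zero
  normalized := by
    rw [FunLike.coe_sum, Finset.sum_apply]
    simp only [VectorMeasure.dirac_apply_of_mem MeasurableSet.univ (Set.mem_univ _)]
    rw [← mem_unitaryGroup_iff.1 hA.eigenvectorUnitary.2]
    ext j k
    simp [Matrix.sum_apply, vecMulVec_apply, Matrix.mul_apply, Matrix.star_apply]

end Observable

/-- The spectral measure `E^e` of the component `e · L`. -/
def spinObservable (N : ℕ) (e : E3) : Observable N ℝ :=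
  Observable.spectral (LComp N e) (LComp_isHermitian N e)

/-! ### Error measures -/

section Errors

variable {N : ℕ} {X : Type*} [MetricSpace X] [MeasurableSpace X]

/-- The power-`α` deviation `(∫ d(y, x)^α μ(dy))^(1/α)` of `μ` from the point `x`, in `[0, ∞]`. -/
def deviation (α : ℝ) (μ : Measure X) (x : X) : ℝ≥0∞ :=
  (∫⁻ y, edist y x ^ α ∂μ) ^ (1 / α)

/-- The Wasserstein `α`-distance, the infimum over all couplings, in `[0, ∞]`. -/
def wasserstein (α : ℝ) (μ ν : Measure X) : ℝ≥0∞ :=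
  ⨅ γ : {γ : Measure (X × X) // γ.map Prod.fst = μ ∧ γ.map Prod.snd = ν},
    (∫⁻ p, edist p.1 p.2 ^ α ∂γ.1) ^ (1 / α)

/-- The metric error `D_α(F, E)`: the worst case Wasserstein distance of the output
distributions. -/
def metricError (α : ℝ) (F E : Observable N X) : ℝ≥0∞ :=
  ⨆ ρ : State N, wasserstein α (F.dist ρ) (E.dist ρ)

/-- The `ε`-calibration error: the worst case deviation of `F` from `x` in states in which `E`
deviates from `x` by at most `ε`. -/
def calErrorAt (α : ℝ) (ε : ℝ≥0∞) (F E : Observable N X) : ℝ≥0∞ :=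
  ⨆ (x : X) (ρ : State N) (_ : deviation α (E.dist ρ) x ≤ ε), deviation α (F.dist ρ) x

lemma calErrorAt_mono (α : ℝ) (F E : Observable N X) : Monotone fun ε => calErrorAt α ε F E :=
  fun _ _ h => iSup_mono fun _ => iSup_mono fun _ => iSup_mono' fun hx => ⟨hx.trans h, le_rfl⟩

/-- The calibration error, the limit of the `ε`-calibration error as `ε → 0`; as the latter is
monotone in `ε`, this is its infimum over `ε > 0` (see `tendsto_calErrorAt`). -/
def calError (α : ℝ) (F E : Observable N X) : ℝ≥0∞ :=
  ⨅ (ε : ℝ≥0∞) (_ : 0 < ε), calErrorAt α ε F E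

lemma tendsto_calErrorAt (α : ℝ) (F E : Observable N X) :
    Filter.Tendsto (fun ε => calErrorAt α ε F E) (𝓝[>] 0) (𝓝 (calError α F E)) := by
  have h := (calErrorAt_mono α F E).tendsto_nhdsGT 0
  rwa [sInf_image] at h

end Errors

/-- The worst-direction metric error `D_max(F)`. -/
def DMax {N : ℕ} (α : ℝ) (F : Observable N E3) : ℝ≥0∞ :=
  ⨆ e : Metric.sphere (0 : E3) 1, metricError α (F.marginal e) (spinObservable N e)

/-- The worst-direction calibration error `Δ_max(F)`. -/
def ΔMax {N : ℕ} (α : ℝ) (F : Observable N E3) : ℝ≥0∞ :=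
  ⨆ e : Metric.sphere (0 : E3) 1, calError α (F.marginal e) (spinObservable N e)

end AngularMomentum

end

open AngularMomentum

open AngularMomentum MeasureTheory Matrix Polynomial
open scoped ENNReal NNReal Topology ComplexOrder

noncomputable section

namespace AngularMomentum

section

/-! Invariance is a change of variables. Since `U_g (e · L) U_g* = (R_g e) · L`
(`spinRep_conj_LComp`), the output distributions of `T_g F` and of the spectral measure in direction
`e` and state `ρ` are those of `F` and of the spectral measure in direction `R_g⁻¹ e` and state
`U_g* ρ U_g`. The suprema over states and directions absorb the substitution. The vector
transformation law is obtained by differentiating the spin representation, extended to all `2 × 2`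
matrices, at the identity.

Convexity holds because output distributions are affine in the observable: `deviation ^ α` is linear
in the measure, and `wasserstein ^ α` is jointly convex because couplings can be mixed. Suprema and
the limit `ε → 0` preserve convexity.

For the infima, `F` is averaged over the Haar measure of `SU(2)`. The average is covariant by left
invariance (`average_isCovariant`), so it suffices that averaging does not increase either error.
This requires convexity for integrals, not just for finite mixtures, and each error raises its own
difficulty.

Metric error: mixing near-optimal couplings over `g` would require a measurable selection.
Kantorovich duality avoids it. The spectral measure has finite support, so the dual functional `∫
min_a (d(y, a)^α + u_a) μ(dy)` has finitely many parameters and is linear in `μ`, hence commutes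
with averaging (`wasserstein_bind_rpow_le`). Strong duality comes from a Hahn-Banach separation in
finite dimensions (`mem_closure_planSet`, `exists_plan`).

Calibration error: the limit `ε → 0` need not be uniform in `g`. For observables with finite
moments, compactness of the state space bounds the limit by the worst deviation in states in which
the reference observable is sharp (`calError_le_of_sharp`), and for a fixed sharp state the
deviation power is an integral over `g`.

In both cases an infinite error is trivial, while a finite one forces the moments of `F`, and then
of its average, to be finite. -/

/-! ### Rotations and Pauli matrices -/

/-- The matrix `x · σ`. -/
def pauliVec (x : E3) : Matrix (Fin 2) (Fin 2) ℂ := ∑ i, (x i : ℂ) • pauli i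

lemma pauliVec_eq (x : E3) :
    pauliVec x = !![(x 2 : ℂ), x 0 - x 1 * Complex.I; x 0 + x 1 * Complex.I, -x 2] := by
  ext i j
  fin_cases i <;> fin_cases j <;> simp [pauliVec, pauli, Fin.sum_univ_three] <;> ring

lemma pauliVec_isHermitian (x : E3) : (pauliVec x)ᴴ = pauliVec x := by
  rw [pauliVec_eq]
  ext i j
  fin_cases i <;> fin_cases j <;> simp [Matrix.conjTranspose_apply] <;> ring

lemma trace_pauliVec (x : E3) : trace (pauliVec x) = 0 := by
  simp [pauliVec_eq, trace_fin_two]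

lemma inner_eq_trace_pauliVec (x y : E3) :
    inner ℝ x y = (trace (pauliVec x * pauliVec y)).re / 2 := by
  simp [pauliVec_eq, trace_fin_two, PiLp.inner_apply, Fin.sum_univ_three]
  ring

lemma pauliVec_injective : Function.Injective pauliVec := fun x y h => by
  refine ext_inner_right ℝ fun v => ?_
  rw [inner_eq_trace_pauliVec, inner_eq_trace_pauliVec, h]

/-- A traceless Hermitian matrix `M` is `y · σ` for `yᵢ = tr (σᵢ M) / 2`. -/
lemma eq_pauliVec_of_isHermitian {M : Matrix (Fin 2) (Fin 2) ℂ} (hM : Mᴴ = M) (ht : trace M = 0) :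
    M = pauliVec (WithLp.toLp 2 fun i => (trace (pauli i * M)).re / 2) := by
  have h00 := congrFun (congrFun hM 0) 0
  have h01 := congrFun (congrFun hM 0) 1
  rw [trace_fin_two] at ht
  have h11 : M 1 1 = - M 0 0 := by linear_combination ht
  simp only [conjTranspose_apply] at h00 h01
  have him : (M 0 0).im = 0 := by
    have := congrArg Complex.im h00
    simp at this
    linarith
  have hre := congrArg Complex.re h01
  have him' := congrArg Complex.im h01
  simp at hre him'
  rw [pauliVec_eq]
  ext i j
  fin_cases i <;> fin_cases j <;> apply Complex.ext <;>
    simp [pauli, trace_fin_two, Matrix.vecMul, dotProduct, Fin.sum_univ_two, h11, him] <;> linarith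

lemma SU2.conjTranspose_mul_self (g : SU2) : g.1ᴴ * g.1 = 1 := by
  rw [← star_eq_conjTranspose]; exact mem_unitaryGroup_iff'.1 g.2.1

lemma SU2.mul_conjTranspose_self (g : SU2) : g.1 * g.1ᴴ = 1 := by
  rw [← star_eq_conjTranspose]; exact mem_unitaryGroup_iff.1 g.2.1

/-- The right side is Hermitian and traceless, so its Pauli coordinates determine it, and these are
the entries of `rotMatrix g` applied to `x`. The homomorphism and isometry properties of `rot`
become matrix identities through this formula. -/
lemma pauliVec_rot (g : SU2) (x : E3) : pauliVec (rot g x) = g.1 * pauliVec x * g.1ᴴ := by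
  have h := eq_pauliVec_of_isHermitian (M := g.1 * pauliVec x * g.1ᴴ)
    (by simp [conjTranspose_mul, pauliVec_isHermitian, Matrix.mul_assoc])
    (by rw [trace_mul_comm, ← Matrix.mul_assoc, SU2.conjTranspose_mul_self, Matrix.one_mul, trace_pauliVec])
  rw [h]
  congr 1
  ext i
  have : rot g x i = ∑ j, rotMatrix g i j * x j := by
    simp [rot, Matrix.mulVec, dotProduct]
  rw [this]
  have e : trace (pauli i * (g.1 * pauliVec x * g.1ᴴ))
      = ∑ j, (x j : ℂ) * trace (pauli i * g.1 * pauli j * g.1ᴴ) := by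
    simp [pauliVec, Matrix.mul_sum, Matrix.sum_mul, Matrix.mul_assoc, trace_sum]
  change _ = (trace (pauli i * (g.1 * pauliVec x * g.1ᴴ))).re / 2
  rw [e, Complex.re_sum, Finset.sum_div]
  refine Finset.sum_congr rfl fun j _ => ?_
  rw [Complex.re_ofReal_mul]
  simp [rotMatrix]
  ring

lemma rot_mul (g h : SU2) (x : E3) : rot (g * h) x = rot g (rot h x) := by
  apply pauliVec_injective
  rw [pauliVec_rot, pauliVec_rot, pauliVec_rot]
  change (g.1 * h.1) * _ * (g.1 * h.1)ᴴ = _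
  simp only [conjTranspose_mul, Matrix.mul_assoc]

lemma rot_one (x : E3) : rot 1 x = x := by
  apply pauliVec_injective
  rw [pauliVec_rot]
  simp

lemma inner_rot_rot (g : SU2) (x y : E3) : inner ℝ (rot g x) (rot g y) = inner ℝ x y := by
  rw [inner_eq_trace_pauliVec, inner_eq_trace_pauliVec, pauliVec_rot, pauliVec_rot]
  have : g.1 * pauliVec x * g.1ᴴ * (g.1 * pauliVec y * g.1ᴴ)
      = g.1 * (pauliVec x * pauliVec y * g.1ᴴ) := by
    calc _ = g.1 * pauliVec x * (g.1ᴴ * g.1) * pauliVec y * g.1ᴴ := by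
          simp only [Matrix.mul_assoc]
      _ = _ := by rw [SU2.conjTranspose_mul_self]; simp only [Matrix.mul_assoc, Matrix.mul_one]
  rw [this, trace_mul_comm, Matrix.mul_assoc, SU2.conjTranspose_mul_self, Matrix.mul_one]

lemma norm_rot (g : SU2) (x : E3) : ‖rot g x‖ = ‖x‖ := by
  rw [← sq_eq_sq₀ (norm_nonneg _) (norm_nonneg _), ← real_inner_self_eq_norm_sq,
    ← real_inner_self_eq_norm_sq, inner_rot_rot]

lemma inner_rot (g : SU2) (x y : E3) : inner ℝ x (rot g y) = inner ℝ (rot g⁻¹ x) y := by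
  rw [← inner_rot_rot g (rot g⁻¹ x) y, ← rot_mul, mul_inv_cancel, rot_one]

/-! ### The infinitesimal action -/

/-- The derivative of `t ↦ spinMatrix N (1 + t A)` at `t = 0`. -/
def spinDeriv (N : ℕ) (A : Matrix (Fin 2) (Fin 2) ℂ) : Op N :=
  diagonal (fun k : Fin (N + 1) => ((N : ℂ) - ((k : ℕ) : ℂ)) * A 0 0 + ((k : ℕ) : ℂ) * A 1 1) +
    A 0 1 • Lplus N + A 1 0 • (Lplus N)ᴴ

/-- This identifies angular momentum as the infinitesimal generator of the spin representation, so
that its covariance can be read off from multiplicativity of `spinMatrix`. -/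
lemma LComp_eq_spinDeriv (N : ℕ) (e : E3) :
    LComp N e = spinDeriv N ((1 / 2 : ℂ) • pauliVec e) := by
  have hI : (1 / (2 * Complex.I)) = - Complex.I / 2 := by
    field_simp; simp
  rw [LComp, Fin.sum_univ_three, spinDeriv, pauliVec_eq]
  ext j k
  simp [L, hI, diagonal_apply, magnetic]
  split_ifs
  · ring
  · ring

/-- The product rule is taken coefficientwise, so no topology on `ℂ[X]` is involved. -/
lemma hasDerivAt_coeff_mul {P Q : ℂ → ℂ[X]} {P' Q' : ℂ[X]} {x : ℂ}
    (hP : ∀ j, HasDerivAt (fun t => (P t).coeff j) (P'.coeff j) x)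
    (hQ : ∀ j, HasDerivAt (fun t => (Q t).coeff j) (Q'.coeff j) x) (j : ℕ) :
    HasDerivAt (fun t => (P t * Q t).coeff j) ((P' * Q x + P x * Q').coeff j) x := by
  simp only [coeff_add, coeff_mul, ← Finset.sum_add_distrib]
  exact HasDerivAt.fun_sum fun i _ => (hP i.1).mul (hQ i.2)

lemma hasDerivAt_coeff_pow {P : ℂ → ℂ[X]} {P' : ℂ[X]} {x : ℂ}
    (hP : ∀ j, HasDerivAt (fun t => (P t).coeff j) (P'.coeff j) x) (n j : ℕ) :
    HasDerivAt (fun t => (P t ^ n).coeff j) (((n : ℂ[X]) * P x ^ (n - 1) * P').coeff j) x := by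
  induction n generalizing j with
  | zero => simpa using hasDerivAt_const x _
  | succ n ih =>
    have := hasDerivAt_coeff_mul ih hP j
    refine (HasDerivAt.congr_deriv (by exact this) ?_)
    congr 1
    rcases n with _ | n
    · simp
    · push_cast
      ring

lemma hasDerivAt_coeff_linear (a b c d : ℂ) (j : ℕ) :
    HasDerivAt (fun t : ℂ => (C (a + t * b) + C (c + t * d) * X : ℂ[X]).coeff j)
      ((C b + C d * X : ℂ[X]).coeff j) 0 := by
  rcases j with _ | _ | j
  · simpa using ((hasDerivAt_id (0 : ℂ)).mul_const b).const_add a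
  · simpa [coeff_C_succ] using ((hasDerivAt_id (0 : ℂ)).mul_const d).const_add c
  · simpa [coeff_C_succ, coeff_X] using hasDerivAt_const (0 : ℂ) (0 : ℂ)

/-- The recursion `(l + 1) * choose N (l + 1) = (N - l) * choose N l` shows that the normalization
of the monomial basis turns the integer coefficients of the derivative into the symmetric ladder
elements of `Lplus`. -/
lemma sqrt_choose_ratio {N l : ℕ} (hl : l + 1 ≤ N) :
    √(N.choose (l + 1) : ℝ) / √(N.choose l) * (l + 1) = √((l + 1) * (N - l)) ∧
    √(N.choose l : ℝ) / √(N.choose (l + 1)) * (N - l) = √((l + 1) * (N - l)) := by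
  have hp : ∀ m : ℕ, m ≤ N → 0 < √(N.choose m : ℝ) := fun m hm =>
    Real.sqrt_pos.2 (by exact_mod_cast Nat.choose_pos hm)
  have ha := hp (l + 1) hl
  have hb := hp l (by omega)
  have hN : (0 : ℝ) ≤ N - l := by
    have : ((l + 1 : ℕ) : ℝ) ≤ N := by exact_mod_cast hl
    push_cast at this
    linarith
  have h : √(N.choose (l + 1) : ℝ) ^ 2 * (l + 1) = √(N.choose l : ℝ) ^ 2 * (N - l) := by
    rw [Real.sq_sqrt (by positivity), Real.sq_sqrt (by positivity)]
    have := Nat.choose_succ_right_eq N l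
    have h2 := congrArg (Nat.cast (R := ℝ)) this
    rwa [Nat.cast_mul, Nat.cast_mul, Nat.cast_sub (by omega), Nat.cast_add, Nat.cast_one] at h2
  constructor
  · symm
    rw [Real.sqrt_eq_iff_mul_self_eq (by positivity) (by positivity)]
    field_simp
    linear_combination -h
  · symm
    rw [Real.sqrt_eq_iff_mul_self_eq (by positivity) (by positivity)]
    field_simp
    linear_combination ((N : ℝ) - l) * h

lemma Lplus_apply_succ {N : ℕ} {j k : Fin (N + 1)} (h : (j : ℕ) + 1 = k) :
    Lplus N j k = (√(((j : ℕ) + 1) * (N - (j : ℕ))) : ℝ) := by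
  have hk : (k : ℕ) = (j : ℝ) + 1 := by exact_mod_cast h.symm
  rw [Lplus, of_apply, if_pos h]
  congr 2
  rw [magnetic, hk]
  ring

lemma hasDerivAt_spinMatrix (N : ℕ) (A : Matrix (Fin 2) (Fin 2) ℂ) (j k : Fin (N + 1)) :
    HasDerivAt (fun t : ℂ => spinMatrix N (1 + t • A) j k) (spinDeriv N A j k) 0 := by
  have h1 := hasDerivAt_coeff_linear 1 (A 0 0) 0 (A 1 0)
  have h2 := hasDerivAt_coeff_linear 0 (A 0 1) 1 (A 1 1)
  have h := (hasDerivAt_coeff_mul (hasDerivAt_coeff_pow h1 (N - k)) (hasDerivAt_coeff_pow h2 k)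
    j).const_mul ((√(N.choose k) / √(N.choose j) : ℝ) : ℂ)
  have e : ∀ t : ℂ, spinMatrix N (1 + t • A) j k = ((√(N.choose k) / √(N.choose j) : ℝ) : ℂ) *
      ((C (1 + t * A 0 0) + C (0 + t * A 1 0) * X) ^ (N - k) *
        (C (0 + t * A 0 1) + C (1 + t * A 1 1) * X) ^ (k : ℕ)).coeff j := fun t => by
    simp [spinMatrix, spinCoeff]
  simp only [e]
  refine h.congr_deriv ?_
  have hk : (k : ℕ) ≤ N := Nat.lt_succ_iff.1 k.2
  have hj : (j : ℕ) ≤ N := Nat.lt_succ_iff.1 j.2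
  -- At `t = 0` the polynomial is `X ^ k`; to first order it changes only in degrees `k`, `k + 1`
  -- and `k - 1`, which give the diagonal, lowering and raising terms.
  have hpol : ((N - k : ℕ) : ℂ[X]) * (C (1 + 0 * A 0 0) + C (0 + 0 * A 1 0) * X) ^ (N - k - 1)
        * (C (A 0 0) + C (A 1 0) * X) * (C (0 + 0 * A 0 1) + C (1 + 0 * A 1 1) * X) ^ (k : ℕ)
      + (C (1 + 0 * A 0 0) + C (0 + 0 * A 1 0) * X) ^ (N - k) *
        (((k : ℕ) : ℂ[X]) * (C (0 + 0 * A 0 1) + C (1 + 0 * A 1 1) * X) ^ ((k : ℕ) - 1)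
          * (C (A 0 1) + C (A 1 1) * X))
      = C ((N - k : ℕ) * A 0 0 + (k : ℕ) * A 1 1) * X ^ (k : ℕ)
        + C ((N - k : ℕ) * A 1 0) * X ^ ((k : ℕ) + 1) + C ((k : ℕ) * A 0 1) * X ^ ((k : ℕ) - 1) := by
    simp only [zero_mul, add_zero, zero_add, C_0, C_1, one_pow, one_mul, mul_one, C_add, C_mul,
      map_natCast]
    rcases (k : ℕ) with _ | m
    · simp only [Nat.cast_zero]; ring
    · simp only [Nat.add_sub_cancel]; ring
  rw [hpol]
  simp only [coeff_add, coeff_C_mul_X_pow]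
  have hN : ((N - k : ℕ) : ℂ) = N - (k : ℕ) := by push_cast [hk]; ring
  rw [hN, spinDeriv]
  simp only [Matrix.add_apply, Matrix.smul_apply, conjTranspose_apply, smul_eq_mul]
  by_cases h0 : j = k
  · subst h0
    have hz : Lplus N j j = 0 := by simp [Lplus]
    have hp : (√(N.choose j) / √(N.choose j) : ℝ) = 1 :=
      div_self (Real.sqrt_pos.2 (by exact_mod_cast Nat.choose_pos hj)).ne'
    -- Truncated subtraction makes the condition true at `j = 0`, where the factor `j` vanishes.
    have : ((if (j : ℕ) = j - 1 then (j : ℕ) * A 0 1 else 0 : ℂ)) = 0 := by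
      split_ifs with hh
      · have : (j : ℕ) = 0 := by omega
        simp [this]
      · rfl
    rw [this, hz, hp]
    simp
  have h0' : (j : ℕ) ≠ k := fun hh => h0 (Fin.ext hh)
  rw [diagonal_apply_ne _ h0, if_neg h0']
  by_cases h1 : (j : ℕ) = k + 1
  · have hz : Lplus N j k = 0 := by simp [Lplus]; omega
    rw [hz, Lplus_apply_succ h1.symm, if_pos h1, if_neg (by omega), h1]
    have := (sqrt_choose_ratio (N := N) (l := k) (by omega)).2
    rw [← this]
    simp
    ring
  by_cases h2 : (j : ℕ) + 1 = k
  · have hz : Lplus N k j = 0 := by simp [Lplus]; omega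
    rw [hz, Lplus_apply_succ h2, if_neg h1, if_pos (by omega), ← h2]
    have := (sqrt_choose_ratio (N := N) (l := j) (by omega)).1
    rw [← this]
    simp
    ring
  have hz : Lplus N j k = 0 := by simp [Lplus]; omega
  have hz' : Lplus N k j = 0 := by simp [Lplus]; omega
  have : ((if (j : ℕ) = k - 1 then (k : ℕ) * A 0 1 else 0 : ℂ)) = 0 := by
    split_ifs with hh
    · have : (k : ℕ) = 0 := by omega
      simp [this]
    · rfl
  rw [this, hz, hz', if_neg h1]
  simp

/-- Both sides are the derivative at `0` of `spinMatrix N (g (1 + t A) g*)`. Multiplicativity of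
`spinMatrix` holds for all `2 × 2` matrices, so `1 + t A` need not be unitary. -/
lemma spinMatrix_conj_spinDeriv (N : ℕ) (g : SU2) (A : Matrix (Fin 2) (Fin 2) ℂ) :
    spinMatrix N g.1 * spinDeriv N A * (spinMatrix N g.1)ᴴ = spinDeriv N (g.1 * A * g.1ᴴ) := by
  ext j k
  refine HasDerivAt.unique (f := fun t : ℂ => spinMatrix N (1 + t • (g.1 * A * g.1ᴴ)) j k) (x := 0)
    ?_ (hasDerivAt_spinMatrix N _ j k)
  have e : ∀ t : ℂ, spinMatrix N (1 + t • (g.1 * A * g.1ᴴ)) j k =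
      ∑ l, (∑ m, spinMatrix N g.1 j m * spinMatrix N (1 + t • A) m l) *
        (spinMatrix N g.1)ᴴ l k := fun t => by
    have : 1 + t • (g.1 * A * g.1ᴴ) = g.1 * (1 + t • A) * g.1ᴴ := by
      rw [Matrix.mul_add, Matrix.add_mul, Matrix.mul_one, SU2.mul_conjTranspose_self]
      simp
    rw [this, spinMatrix_mul, spinMatrix_mul, ← spinMatrix_conjTranspose, Matrix.mul_apply]
    simp only [Matrix.mul_apply]
  simp only [e]
  simp only [Matrix.mul_apply]
  exact HasDerivAt.fun_sum fun l _ => (HasDerivAt.fun_sum fun m _ =>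
    (hasDerivAt_spinMatrix N A m l).const_mul _).mul_const _

/-- The operators `e · L` transform as vectors under the spin representation. -/
lemma spinRep_conj_LComp (N : ℕ) (g : SU2) (e : E3) :
    (spinRep N g).1 * LComp N e * (spinRep N g).1ᴴ = LComp N (rot g e) := by
  rw [LComp_eq_spinDeriv, LComp_eq_spinDeriv, pauliVec_rot]
  change spinMatrix N g.1 * _ * (spinMatrix N g.1)ᴴ = _
  rw [spinMatrix_conj_spinDeriv]
  simp

namespace Observable

variable {N : ℕ}

/-- Expressing the spectral measure by the functional calculus removes the dependence on the chosen
eigenbasis; the bases chosen for `A` and for `U A U*` are unrelated. -/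
lemma spectral_apply (A : Op N) (hA : A.IsHermitian) {S : Set ℝ} (hS : MeasurableSet S) :
    (spectral A hA).toVectorMeasure S = cfc (S.indicator 1) A := by
  rw [hA.cfc_eq, IsHermitian.cfc, Unitary.conjStarAlgAut_apply]
  change (∑ i, VectorMeasure.dirac (hA.eigenvalues i)
    (vecMulVec (hA.eigenvectorBasis i) (star (hA.eigenvectorBasis i : Fin (N + 1) → ℂ)))) S = _
  rw [FunLike.coe_sum, Finset.sum_apply]
  ext j k
  simp only [Matrix.sum_apply, Matrix.mul_apply, diagonal_apply, mul_ite, mul_zero,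
    Finset.sum_ite_eq', Finset.mem_univ, if_true]
  refine Finset.sum_congr rfl fun i _ => ?_
  by_cases hi : hA.eigenvalues i ∈ S
  · rw [VectorMeasure.dirac_apply_of_mem hS hi]
    simp [hi, vecMulVec_apply, star_apply]
  · rw [VectorMeasure.dirac_apply_of_notMem hi]
    simp [hi]

lemma spectral_conj (A : Op N) (hA : A.IsHermitian) (U : unitaryGroup (Fin (N + 1)) ℂ) (B : Op N)
    (hB : B.IsHermitian) (h : U.1 * A * U.1ᴴ = B) {S : Set ℝ} (hS : MeasurableSet S) :
    (spectral B hB).toVectorMeasure S = U.1 * (spectral A hA).toVectorMeasure S * U.1ᴴ := by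
  rw [spectral_apply A hA hS, spectral_apply B hB hS]
  have := StarAlgHomClass.map_cfc (R := ℝ) (S := ℂ) (Unitary.conjStarAlgAut ℂ (Op N) U)
    (S.indicator 1) A (A.finite_real_spectrum.continuousOn _)
    (by exact (continuous_const.matrix_mul continuous_id).matrix_mul continuous_const) hA
    (by
      change (U.1 * A * U.1ᴴ).IsHermitian
      rwa [h])
  rw [Unitary.conjStarAlgAut_apply, Unitary.conjStarAlgAut_apply] at this
  rw [← h]
  exact this.symm

end Observable

lemma spinObservable_rot (N : ℕ) (g : SU2) (e : E3) {S : Set ℝ} (hS : MeasurableSet S) :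
    (spinObservable N (rot g e)).toVectorMeasure S =
      (spinRep N g).1 * (spinObservable N e).toVectorMeasure S * (spinRep N g).1ᴴ :=
  Observable.spectral_conj _ _ _ _ _ (spinRep_conj_LComp N g e) hS

end

section

/-! ### Output distributions -/

variable {N : ℕ}

lemma spinRep_conjTranspose_mul_self (g : SU2) : (spinRep N g).1ᴴ * (spinRep N g).1 = 1 := by
  rw [← star_eq_conjTranspose]; exact mem_unitaryGroup_iff'.1 (spinRep N g).2

lemma spinRep_mul_conjTranspose_self (g : SU2) : (spinRep N g).1 * (spinRep N g).1ᴴ = 1 := by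
  rw [← star_eq_conjTranspose]; exact mem_unitaryGroup_iff.1 (spinRep N g).2

lemma spinRep_inv (g : SU2) : (spinRep N g⁻¹).1 = (spinRep N g).1ᴴ := by
  rw [map_inv]; rfl

@[ext]
lemma State.ext {ρ σ : State N} (h : ρ.toOp = σ.toOp) : ρ = σ := by
  cases ρ; cases σ; simp_all

/-- The rotated state `U_g* ρ U_g`. -/
def State.rotate (g : SU2) (ρ : State N) : State N where
  toOp := (spinRep N g).1ᴴ * ρ.toOp * (spinRep N g).1
  posSemidef := ρ.posSemidef.conjTranspose_mul_mul_same _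
  trace_eq_one := by
    rw [trace_mul_comm, ← Matrix.mul_assoc, spinRep_mul_conjTranspose_self, Matrix.one_mul,
      ρ.trace_eq_one]

lemma State.rotate_surjective (g : SU2) : Function.Surjective (State.rotate (N := N) g) :=
  fun ρ => ⟨ρ.rotate g⁻¹, by
    ext1
    simp only [State.rotate, spinRep_inv, conjTranspose_conjTranspose]
    rw [← Matrix.mul_assoc, ← Matrix.mul_assoc, spinRep_conjTranspose_mul_self, Matrix.one_mul,
      Matrix.mul_assoc, spinRep_conjTranspose_mul_self, Matrix.mul_one]⟩

namespace Observable

variable {Ω : Type*} [MeasurableSpace Ω]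

instance (F : Observable N Ω) (ρ : State N) : IsProbabilityMeasure (F.dist ρ) :=
  ⟨by rw [dist_apply _ _ MeasurableSet.univ, F.normalized, Matrix.mul_one, ρ.trace_eq_one]; simp⟩

lemma re_trace_nonneg (F : Observable N Ω) (ρ : State N) (S : Set Ω) :
    0 ≤ (trace (ρ.toOp * F.toVectorMeasure S)).re :=
  re_trace_mul_nonneg ρ.posSemidef (F.posSemidef S)

lemma dist_marginal (F : Observable N E3) (e : E3) (ρ : State N) :
    (F.marginal e).dist ρ = (F.dist ρ).map fun η => inner ℝ e η := by
  ext S hS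
  rw [Measure.map_apply (measurable_inner_left e) hS, dist_apply _ _ hS,
    dist_apply _ _ (measurable_inner_left e hS), marginal,
    VectorMeasure.map_apply _ (measurable_inner_left e) hS]

lemma dist_mix (a b : ℝ≥0) (hab : a + b = 1) (F G : Observable N Ω) (ρ : State N) :
    (mix a b hab F G).dist ρ = a • F.dist ρ + b • G.dist ρ := by
  ext S hS
  rw [Measure.add_apply, Measure.smul_apply, Measure.smul_apply, dist_apply _ _ hS,
    dist_apply _ _ hS, dist_apply _ _ hS]
  have : (mix a b hab F G).toVectorMeasure S
      = (a : ℝ) • F.toVectorMeasure S + (b : ℝ) • G.toVectorMeasure S := rfl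
  rw [this, Matrix.mul_add, Matrix.mul_smul, Matrix.mul_smul, trace_add, trace_smul, trace_smul,
    Complex.add_re, Complex.smul_re, Complex.smul_re, smul_eq_mul, smul_eq_mul,
    ENNReal.ofReal_add (mul_nonneg a.coe_nonneg (re_trace_nonneg F ρ S))
      (mul_nonneg b.coe_nonneg (re_trace_nonneg G ρ S)), ENNReal.ofReal_mul a.coe_nonneg,
    ENNReal.ofReal_mul b.coe_nonneg]
  simp [ENNReal.smul_def]

lemma dist_marginal_mix (a b : ℝ≥0) (hab : a + b = 1) (F G : Observable N E3) (e : E3)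
    (ρ : State N) : ((mix a b hab F G).marginal e).dist ρ =
      a • (F.marginal e).dist ρ + b • (G.marginal e).dist ρ := by
  simp only [dist_marginal, dist_mix]
  rw [Measure.map_add _ _ (measurable_inner_left e), Measure.map_smul, Measure.map_smul]

lemma dist_T (g : SU2) (F : Observable N E3) (ρ : State N) :
    (F.T g).dist ρ = (F.dist (ρ.rotate g)).map (rot g) := by
  ext S hS
  rw [Measure.map_apply (rot g).continuous.measurable hS, dist_apply _ _ hS,
    dist_apply _ _ ((rot g).continuous.measurable hS), T_apply _ _ hS, ← Matrix.mul_assoc,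
    trace_mul_comm]
  simp only [State.rotate, Matrix.mul_assoc]

/-- Since `e · R_g η = R_g⁻¹ e · η`, the rotation of the observable is moved to the direction and
the state. `dist_spinObservable` is the counterpart for the spectral measures. -/
lemma dist_marginal_T (g : SU2) (F : Observable N E3) (e : E3) (ρ : State N) :
    ((F.T g).marginal e).dist ρ = (F.marginal (rot g⁻¹ e)).dist (ρ.rotate g) := by
  rw [dist_marginal, dist_marginal, dist_T,
    Measure.map_map (measurable_inner_left e) (rot g).continuous.measurable]
  congr 1
  ext η
  exact inner_rot g e η

end Observable

lemma dist_spinObservable (g : SU2) (e : E3) (ρ : State N) :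
    (spinObservable N e).dist ρ = (spinObservable N (rot g⁻¹ e)).dist (ρ.rotate g) := by
  ext S hS
  have h := spinObservable_rot N g (rot g⁻¹ e) hS
  rw [← rot_mul, mul_inv_cancel, rot_one] at h
  rw [Observable.dist_apply _ _ hS, Observable.dist_apply _ _ hS, h, ← Matrix.mul_assoc,
    trace_mul_comm]
  simp only [State.rotate, Matrix.mul_assoc]

/-! ### Rotation invariance of the errors -/

section Congr

variable {X : Type*} [MetricSpace X] [MeasurableSpace X] {F E F' E' : Observable N X}
  {φ : State N → State N}

lemma metricError_congr (α : ℝ) (hφ : φ.Surjective) (hF : ∀ ρ, F.dist ρ = F'.dist (φ ρ))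
    (hE : ∀ ρ, E.dist ρ = E'.dist (φ ρ)) : metricError α F E = metricError α F' E' := by
  simp only [metricError, hF, hE]
  exact hφ.iSup_comp (g := fun ρ => wasserstein α (F'.dist ρ) (E'.dist ρ))

lemma calError_congr (α : ℝ) (hφ : φ.Surjective) (hF : ∀ ρ, F.dist ρ = F'.dist (φ ρ))
    (hE : ∀ ρ, E.dist ρ = E'.dist (φ ρ)) : calError α F E = calError α F' E' := by
  simp only [calError, calErrorAt, hF, hE]
  refine iInf_congr fun ε => iInf_congr fun _ => iSup_congr fun x => ?_
  exact hφ.iSup_comp (g := fun ρ => ⨆ (_ : deviation α (E'.dist ρ) x ≤ ε),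
    deviation α (F'.dist ρ) x)

end Congr

lemma metricError_T (α : ℝ) (g : SU2) (F : Observable N E3) (e : E3) :
    metricError α ((F.T g).marginal e) (spinObservable N e) =
      metricError α (F.marginal (rot g⁻¹ e)) (spinObservable N (rot g⁻¹ e)) :=
  metricError_congr α (State.rotate_surjective g) (F.dist_marginal_T g e) (dist_spinObservable g e)

lemma calError_T (α : ℝ) (g : SU2) (F : Observable N E3) (e : E3) :
    calError α ((F.T g).marginal e) (spinObservable N e) =
      calError α (F.marginal (rot g⁻¹ e)) (spinObservable N (rot g⁻¹ e)) :=
  calError_congr α (State.rotate_surjective g) (F.dist_marginal_T g e) (dist_spinObservable g e)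

/-- The rotation `R_g` on the unit sphere. -/
def sphereRot (g : SU2) (e : Metric.sphere (0 : E3) 1) : Metric.sphere (0 : E3) 1 :=
  ⟨rot g e, by simp [norm_rot]⟩

lemma sphereRot_surjective (g : SU2) : Function.Surjective (sphereRot g) := fun e =>
  ⟨sphereRot g⁻¹ e, Subtype.ext (by simp [sphereRot, ← rot_mul, rot_one])⟩

lemma DMax_T (α : ℝ) (g : SU2) (F : Observable N E3) : DMax α (F.T g) = DMax α F := by
  simp only [DMax, metricError_T]
  exact (sphereRot_surjective g⁻¹).iSup_comp
    (g := fun e => metricError α (F.marginal e) (spinObservable N e))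

lemma ΔMax_T (α : ℝ) (g : SU2) (F : Observable N E3) : ΔMax α (F.T g) = ΔMax α F := by
  simp only [ΔMax, calError_T]
  exact (sphereRot_surjective g⁻¹).iSup_comp
    (g := fun e => calError α (F.marginal e) (spinObservable N e))

/-! ### Convexity -/

lemma deviation_le_calErrorAt {X : Type*} [MetricSpace X] [MeasurableSpace X] {α : ℝ} {ε : ℝ≥0∞}
    {F E : Observable N X} {ρ : State N} {x : X} (h : deviation α (E.dist ρ) x ≤ ε) :
    deviation α (F.dist ρ) x ≤ calErrorAt α ε F E :=
  le_iSup_of_le x (le_iSup_of_le ρ (le_iSup_of_le h le_rfl))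

section Convexity

variable {X : Type*} [MetricSpace X] [MeasurableSpace X] {α : ℝ}

lemma deviation_rpow (hα : 0 < α) (μ : Measure X) (x : X) :
    deviation α μ x ^ α = ∫⁻ y, edist y x ^ α ∂μ := by
  rw [deviation, ← ENNReal.rpow_mul, one_div_mul_cancel hα.ne', ENNReal.rpow_one]

lemma wasserstein_rpow_le (hα : 0 < α) {μ ν : Measure X} {γ : Measure (X × X)}
    (h1 : γ.map Prod.fst = μ) (h2 : γ.map Prod.snd = ν) :
    wasserstein α μ ν ^ α ≤ ∫⁻ p, edist p.1 p.2 ^ α ∂γ := by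
  have : wasserstein α μ ν ≤ (∫⁻ p, edist p.1 p.2 ^ α ∂γ) ^ (1 / α) :=
    iInf_le (fun γ : {γ : Measure (X × X) // γ.map Prod.fst = μ ∧ γ.map Prod.snd = ν} =>
      (∫⁻ p, edist p.1 p.2 ^ α ∂γ.1) ^ (1 / α)) ⟨γ, h1, h2⟩
  refine (ENNReal.rpow_le_rpow this hα.le).trans_eq ?_
  rw [← ENNReal.rpow_mul, one_div_mul_cancel hα.ne', ENNReal.rpow_one]

lemma exists_coupling_of_wasserstein_rpow_lt (hα : 0 < α) {μ ν : Measure X} {K : ℝ≥0∞}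
    (h : wasserstein α μ ν ^ α < K) : ∃ γ : Measure (X × X), γ.map Prod.fst = μ ∧
      γ.map Prod.snd = ν ∧ ∫⁻ p, edist p.1 p.2 ^ α ∂γ < K := by
  have h' : wasserstein α μ ν < K ^ (1 / α) := by
    rw [← ENNReal.rpow_lt_rpow_iff hα, ← ENNReal.rpow_mul, one_div_mul_cancel hα.ne',
      ENNReal.rpow_one]
    exact h
  obtain ⟨γ, hγ⟩ := iInf_lt_iff.1 h'
  exact ⟨γ.1, γ.2.1, γ.2.2, (ENNReal.rpow_lt_rpow_iff (one_div_pos.2 hα)).1 hγ⟩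

/-- Joint convexity of the power of the Wasserstein distance. -/
lemma wasserstein_mix_rpow_le (hα : 0 < α) (a b : ℝ≥0) (hab : a + b = 1) (μ ν μ' ν' : Measure X) :
    wasserstein α (a • μ + b • μ') (a • ν + b • ν') ^ α ≤
      a * wasserstein α μ ν ^ α + b * wasserstein α μ' ν' ^ α := by
  -- Zero weights are treated apart because `0 * ⊤ = 0`: finiteness of the right side then says
  -- nothing about the distance that carries the zero weight.
  rcases eq_or_ne a 0 with rfl | ha
  · obtain rfl : b = 1 := by simpa using hab
    simp
  rcases eq_or_ne b 0 with rfl | hb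
  · obtain rfl : a = 1 := by simpa using hab
    simp
  refine ENNReal.le_of_forall_pos_le_add fun ε hε hfin => ?_
  have hε' : (ε : ℝ≥0∞) ≠ 0 := by exact_mod_cast hε.ne'
  have h1 : wasserstein α μ ν ^ α ≠ ⊤ := fun h => by
    rw [h, ENNReal.mul_top (by exact_mod_cast ha), top_add] at hfin
    exact lt_irrefl _ hfin
  have h2 : wasserstein α μ' ν' ^ α ≠ ⊤ := fun h => by
    rw [h, ENNReal.mul_top (by exact_mod_cast hb), add_top] at hfin
    exact lt_irrefl _ hfin
  obtain ⟨γ, hγ1, hγ2, hγ⟩ := exists_coupling_of_wasserstein_rpow_lt hα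
    (ENNReal.lt_add_right h1 hε')
  obtain ⟨γ', hγ1', hγ2', hγ'⟩ := exists_coupling_of_wasserstein_rpow_lt hα
    (ENNReal.lt_add_right h2 hε')
  refine (wasserstein_rpow_le hα (γ := a • γ + b • γ') ?_ ?_).trans ?_
  · rw [Measure.map_add _ _ measurable_fst, Measure.map_smul, Measure.map_smul, hγ1, hγ1']
  · rw [Measure.map_add _ _ measurable_snd, Measure.map_smul, Measure.map_smul, hγ2, hγ2']
  · rw [lintegral_add_measure, lintegral_smul_measure, lintegral_smul_measure]
    have h1 : (a : ℝ≥0∞) + b = 1 := by exact_mod_cast hab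
    calc _ ≤ (a : ℝ≥0∞) * (wasserstein α μ ν ^ α + ε) + b * (wasserstein α μ' ν' ^ α + ε) :=
          add_le_add (mul_le_mul_right hγ.le _) (mul_le_mul_right hγ'.le _)
      _ = a * wasserstein α μ ν ^ α + b * wasserstein α μ' ν' ^ α + (a + b) * ε := by ring
      _ = _ := by rw [h1, one_mul]

end Convexity

variable {α : ℝ}

lemma DMax_mix_rpow_le (hα : 0 < α) (a b : ℝ≥0) (hab : a + b = 1) (F G : Observable N E3) :
    DMax α (Observable.mix a b hab F G) ^ α ≤ a * DMax α F ^ α + b * DMax α G ^ α := by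
  rw [← ENNReal.le_rpow_inv_iff hα]
  refine iSup_le fun e => iSup_le fun ρ => ?_
  rw [ENNReal.le_rpow_inv_iff hα, Observable.dist_marginal_mix]
  have h1 : (spinObservable N e).dist ρ
      = a • (spinObservable N e).dist ρ + b • (spinObservable N e).dist ρ := by
    rw [← add_smul, hab, one_smul]
  rw [h1]
  refine (wasserstein_mix_rpow_le hα a b hab _ _ _ _).trans ?_
  have h2 : ∀ F : Observable N E3, wasserstein α ((F.marginal e).dist ρ)
      ((spinObservable N e).dist ρ) ≤ DMax α F := fun F =>
    (le_iSup (fun ρ => wasserstein α ((F.marginal e).dist ρ) ((spinObservable N e).dist ρ)) ρ).trans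
      (le_iSup (fun e : Metric.sphere (0 : E3) 1 =>
        metricError α (F.marginal e) (spinObservable N e)) e)
  gcongr <;> exact h2 _

lemma calErrorAt_mix_rpow_le (hα : 0 < α) (a b : ℝ≥0) (hab : a + b = 1) (F G : Observable N E3)
    (e : E3) (ε : ℝ≥0∞) (E : Observable N ℝ) :
    calErrorAt α ε ((Observable.mix a b hab F G).marginal e) E ^ α ≤
      a * calErrorAt α ε (F.marginal e) E ^ α + b * calErrorAt α ε (G.marginal e) E ^ α := by
  rw [← ENNReal.le_rpow_inv_iff hα]
  refine iSup_le fun x => iSup_le fun ρ => iSup_le fun hx => ?_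
  rw [ENNReal.le_rpow_inv_iff hα, Observable.dist_marginal_mix, deviation_rpow hα,
    lintegral_add_measure, lintegral_smul_measure, lintegral_smul_measure, ← deviation_rpow hα,
    ← deviation_rpow hα]
  have h2 : ∀ F : Observable N E3, deviation α ((F.marginal e).dist ρ) x ≤
      calErrorAt α ε (F.marginal e) E := fun F =>
    deviation_le_calErrorAt hx
  change (a : ℝ≥0∞) * _ + (b : ℝ≥0∞) * _ ≤ _
  gcongr <;> exact h2 _

lemma ΔMax_mix_rpow_le (hα : 0 < α) (a b : ℝ≥0) (hab : a + b = 1) (F G : Observable N E3) :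
    ΔMax α (Observable.mix a b hab F G) ^ α ≤ a * ΔMax α F ^ α + b * ΔMax α G ^ α := by
  rw [← ENNReal.le_rpow_inv_iff hα]
  refine iSup_le fun e => ?_
  rw [ENNReal.le_rpow_inv_iff hα]
  have hlim : ∀ F : Observable N E3, Filter.Tendsto
      (fun ε => calErrorAt α ε (F.marginal e) (spinObservable N e) ^ α) (𝓝[>] 0)
      (𝓝 (calError α (F.marginal e) (spinObservable N e) ^ α)) := fun F =>
    (ENNReal.continuous_rpow_const.tendsto _).comp (tendsto_calErrorAt α _ _)
  have h := le_of_tendsto_of_tendsto' (hlim (Observable.mix a b hab F G))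
    ((ENNReal.Tendsto.const_mul (hlim F) (Or.inr ENNReal.coe_ne_top)).add
      (ENNReal.Tendsto.const_mul (hlim G) (Or.inr ENNReal.coe_ne_top)))
    (fun ε => calErrorAt_mix_rpow_le hα a b hab F G e ε _)
  refine h.trans ?_
  have h2 : ∀ F : Observable N E3, calError α (F.marginal e) (spinObservable N e) ≤ ΔMax α F :=
    fun F => le_iSup (fun e : Metric.sphere (0 : E3) 1 =>
      calError α (F.marginal e) (spinObservable N e)) e
  gcongr <;> exact h2 _

end

section

/-! ### Deviations and moments -/

section Deviation

variable {X : Type*} [MetricSpace X] [MeasurableSpace X] [OpensMeasurableSpace X] {α : ℝ}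

lemma measurable_edist_rpow (x : X) : Measurable fun y : X => edist y x ^ α :=
  (measurable_edist_left).pow_const α

lemma lintegral_const_rpow (hα : 0 < α) {Y : Type*} [MeasurableSpace Y] (μ : Measure Y)
    [IsProbabilityMeasure μ] (c : ℝ≥0∞) : (∫⁻ _, c ^ α ∂μ) ^ (1 / α) = c := by
  rw [lintegral_const, measure_univ, mul_one, ← ENNReal.rpow_mul, mul_one_div_cancel hα.ne',
    ENNReal.rpow_one]

/-- Minkowski's inequality, the source of the condition `1 ≤ α`; it yields all triangle inequalities
between deviations and Wasserstein distances below. -/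
lemma lintegral_rpow_le_add {Y : Type*} [MeasurableSpace Y] (hα : 1 ≤ α) (μ : Measure Y)
    {f g h : Y → ℝ≥0∞} (hg : Measurable g) (hh : Measurable h) (hf : ∀ y, f y ≤ g y + h y) :
    (∫⁻ y, f y ^ α ∂μ) ^ (1 / α) ≤ (∫⁻ y, g y ^ α ∂μ) ^ (1 / α) + (∫⁻ y, h y ^ α ∂μ) ^ (1 / α) := by
  have hα0 : 0 < α := by linarith
  refine le_trans ?_ (ENNReal.lintegral_Lp_add_le hg.aemeasurable hh.aemeasurable hα)
  refine ENNReal.rpow_le_rpow (lintegral_mono fun y => ?_) (by positivity)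
  exact ENNReal.rpow_le_rpow (hf y) hα0.le

lemma deviation_le_add_edist (hα : 1 ≤ α) (μ : Measure X) [IsProbabilityMeasure μ] (x x' : X) :
    deviation α μ x ≤ deviation α μ x' + edist x' x := by
  have hα0 : 0 < α := by linarith
  have := lintegral_rpow_le_add hα μ (f := fun y => edist y x) (g := fun y => edist y x')
    (h := fun _ => edist x' x) measurable_edist_left measurable_const
    (fun y => edist_triangle _ _ _)
  rwa [lintegral_const_rpow hα0] at this

lemma edist_le_deviation_add (hα : 1 ≤ α) (μ : Measure X) [IsProbabilityMeasure μ] (x x' : X) :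
    edist x x' ≤ deviation α μ x + deviation α μ x' := by
  have hα0 : 0 < α := by linarith
  have := lintegral_rpow_le_add hα μ (f := fun _ => edist x x') (g := fun y => edist y x)
    (h := fun y => edist y x') measurable_edist_left measurable_edist_left
    (fun y => by simpa [edist_comm] using edist_triangle x y x')
  rwa [lintegral_const_rpow hα0] at this

lemma deviation_le_wasserstein_add [SecondCountableTopology X] (hα : 1 ≤ α) (μ ν : Measure X)
    (x : X) : deviation α μ x ≤ wasserstein α μ ν + deviation α ν x := by
  rw [wasserstein, ENNReal.iInf_add]
  refine le_iInf fun γ => ?_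
  obtain ⟨γ, rfl, rfl⟩ := γ
  rw [deviation, deviation, lintegral_map (measurable_edist_rpow x) measurable_fst,
    lintegral_map (measurable_edist_rpow x) measurable_snd]
  exact lintegral_rpow_le_add hα γ (measurable_fst.edist measurable_snd)
    (measurable_edist_left.comp measurable_snd) (fun p => edist_triangle _ _ _)

omit [OpensMeasurableSpace X] in
lemma deviation_lt_top_of_finset (hα : 0 < α) (μ : Measure X) [IsFiniteMeasure μ] (s : Finset X)
    (hs : μ (s : Set X)ᶜ = 0) (x : X) : deviation α μ x < ⊤ := by
  have hae : ∀ᵐ y ∂μ, edist y x ^ α ≤ ∑ a ∈ s, edist a x ^ α := by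
    refine (measure_eq_zero_iff_ae_notMem.1 hs).mono fun y hy => ?_
    exact Finset.single_le_sum (f := fun a => edist a x ^ α) (fun _ _ => zero_le)
      (by simpa using hy)
  refine ENNReal.rpow_lt_top_of_nonneg (by positivity) (ne_of_lt ?_)
  refine (lintegral_mono_ae hae).trans_lt ?_
  rw [lintegral_const]
  refine ENNReal.mul_lt_top (ENNReal.sum_lt_top.2 fun a _ => ?_) (measure_lt_top _ _)
  exact ENNReal.rpow_lt_top_of_nonneg hα.le (edist_ne_top _ _)

end Deviation

/-! ### Order bounds for output distributions -/

variable {N : ℕ}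

/-- By Cauchy-Schwarz, `|⟨x, B x⟩| ≤ δ (∑ |x j|)² ≤ (N + 1) δ ‖x‖²`. The crude constant is harmless,
since only its finiteness is used. -/
lemma posSemidef_smul_one_sub {B : Op N} (hB : B.IsHermitian) {δ : ℝ} (h : ∀ j k, ‖B j k‖ ≤ δ) :
    ((((N : ℝ) + 1) * δ) • (1 : Op N) - B).PosSemidef := by
  have hH : ((((N : ℝ) + 1) * δ) • (1 : Op N) - B).IsHermitian := by
    refine IsHermitian.sub ?_ hB
    rw [Matrix.IsHermitian, conjTranspose_smul]
    simp
  refine PosSemidef.of_dotProduct_mulVec_nonneg hH fun x => ?_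
  rw [Complex.nonneg_iff]
  refine ⟨?_, (hH.im_star_dotProduct_mulVec_self x).symm⟩
  have hδ : 0 ≤ δ := (norm_nonneg _).trans (h 0 0)
  have h1 : ‖star x ⬝ᵥ B *ᵥ x‖ ≤ δ * (∑ j, ‖x j‖) ^ 2 := by
    simp only [dotProduct, mulVec]
    refine (norm_sum_le _ _).trans ?_
    rw [sq, Finset.sum_mul, Finset.mul_sum]
    refine Finset.sum_le_sum fun j _ => ?_
    rw [norm_mul, Pi.star_apply, norm_star, mul_left_comm]
    refine mul_le_mul_of_nonneg_left ?_ (norm_nonneg _)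
    rw [Finset.mul_sum]
    refine (norm_sum_le _ _).trans (Finset.sum_le_sum fun k _ => ?_)
    rw [norm_mul]
    exact mul_le_mul_of_nonneg_right (h j k) (norm_nonneg _)
  have h2 : (∑ j, ‖x j‖) ^ 2 ≤ ((N : ℝ) + 1) * ∑ j, ‖x j‖ ^ 2 := by
    have := sq_sum_le_card_mul_sum_sq (s := Finset.univ) (f := fun j => ‖x j‖)
    simpa using this
  have h3 : (star x ⬝ᵥ x).re = ∑ j, ‖x j‖ ^ 2 := by
    rw [dotProduct, Complex.re_sum]
    refine Finset.sum_congr rfl fun j _ => ?_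
    rw [Pi.star_apply, ← Complex.normSq_eq_norm_sq, Complex.normSq_apply]
    simp
  rw [sub_mulVec, dotProduct_sub, smul_mulVec, one_mulVec, dotProduct_smul, Complex.sub_re,
    Complex.smul_re, h3, smul_eq_mul]
  have h4 := (Complex.re_le_norm _).trans h1
  nlinarith [mul_le_mul_of_nonneg_left h2 hδ]

/-- With `A = M* M`, an entry is an inner product of columns of `M`, bounded by the mean of two
diagonal entries. It bounds states here and dominates POVM entries by their traces in the averaging
argument. -/
lemma norm_apply_le_trace {A : Op N} (hA : A.PosSemidef) (j k : Fin (N + 1)) :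
    ‖A j k‖ ≤ (trace A).re := by
  obtain ⟨M, hM⟩ : ∃ M : Op N, A = Mᴴ * M := by
    open scoped MatrixOrder in
    exact CStarAlgebra.nonneg_iff_eq_star_mul_self.mp hA.nonneg
  have hd : ∀ j, (A j j).re = ∑ l, ‖M l j‖ ^ 2 := fun j => by
    rw [hM, Matrix.mul_apply, Complex.re_sum]
    refine Finset.sum_congr rfl fun l _ => ?_
    rw [conjTranspose_apply, ← Complex.normSq_eq_norm_sq, Complex.normSq_apply]
    simp
  have ht : ∑ j, (A j j).re = (trace A).re := by simp [trace]
  have h1 : ∀ j, (A j j).re ≤ (trace A).re := fun j => by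
    rw [← ht]
    refine Finset.single_le_sum (f := fun j => (A j j).re) (fun i _ => ?_) (Finset.mem_univ j)
    rw [hd]
    positivity
  have h2 : ‖A j k‖ ≤ ((A j j).re + (A k k).re) / 2 := by
    rw [hd, hd, ← Finset.sum_add_distrib, Finset.sum_div, hM, Matrix.mul_apply]
    refine (norm_sum_le _ _).trans (Finset.sum_le_sum fun l _ => ?_)
    rw [norm_mul, conjTranspose_apply, norm_star]
    nlinarith [sq_nonneg (‖M l j‖ - ‖M l k‖)]
  linarith [h1 j, h1 k]

lemma State.norm_apply_le (ρ : State N) (j k : Fin (N + 1)) : ‖ρ.toOp j k‖ ≤ 1 := by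
  simpa [ρ.trace_eq_one] using norm_apply_le_trace ρ.posSemidef j k

/-- The maximally mixed state. -/
def State.mixed (N : ℕ) : State N where
  toOp := (1 / ((N : ℝ) + 1)) • 1
  posSemidef := PosSemidef.one.smul (by positivity)
  trace_eq_one := by
    rw [trace_smul, trace_one, Fintype.card_fin]
    have : (N : ℂ) + 1 ≠ 0 := by exact_mod_cast N.succ_ne_zero
    simp
    field_simp

namespace Observable

variable {Ω : Type*} [MeasurableSpace Ω]

/-- The measure `S ↦ tr F(S)`. -/
def traceMeasure (F : Observable N Ω) : Measure Ω := ((N : ℝ≥0) + 1) • F.dist (State.mixed N)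

lemma traceMeasure_apply (F : Observable N Ω) {S : Set Ω} (hS : MeasurableSet S) :
    F.traceMeasure S = ENNReal.ofReal (trace (F.toVectorMeasure S)).re := by
  rw [traceMeasure, Measure.smul_apply, dist_apply _ _ hS]
  have h : (trace ((State.mixed N).toOp * F.toVectorMeasure S)).re =
      1 / ((N : ℝ) + 1) * (trace (F.toVectorMeasure S)).re := by
    simp only [State.mixed, Matrix.smul_mul, Matrix.one_mul, trace_smul, Complex.smul_re,
      smul_eq_mul]
  have hN : ((N : ℝ≥0) + 1 : ℝ≥0) • (ENNReal.ofReal (1 / ((N : ℝ) + 1) *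
      (trace (F.toVectorMeasure S)).re)) = ENNReal.ofReal (((N : ℝ) + 1) * (1 / ((N : ℝ) + 1) *
      (trace (F.toVectorMeasure S)).re)) := by
    rw [ENNReal.ofReal_mul (p := (N : ℝ) + 1) (by positivity), ENNReal.smul_def, smul_eq_mul]
    congr 1
    rw [ENNReal.ofReal_add (by positivity) (by positivity)]
    simp
  rw [h, hN, ← mul_assoc, mul_one_div_cancel (by positivity), one_mul]

/-- The operator inequality `ρ ≤ σ + δ 1` becomes an inequality of measures, which can be integrated
against the unbounded cost `d(y, x)^α`. -/
lemma dist_le_add_smul (F : Observable N Ω) (ρ σ : State N) {δ : ℝ} (hδ : 0 ≤ δ)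
    (h : (δ • (1 : Op N) - (ρ.toOp - σ.toOp)).PosSemidef) :
    F.dist ρ ≤ F.dist σ + δ.toNNReal • F.traceMeasure := by
  refine Measure.le_iff.2 fun S hS => ?_
  rw [Measure.add_apply, Measure.smul_apply, traceMeasure_apply F hS, dist_apply _ _ hS,
    dist_apply _ _ hS, ENNReal.smul_def, smul_eq_mul]
  change _ ≤ _ + ENNReal.ofReal δ * _
  have hp := re_trace_mul_nonneg h (F.posSemidef S)
  have hs := re_trace_mul_nonneg PosSemidef.one (F.posSemidef S)
  rw [Matrix.one_mul] at hs
  rw [← ENNReal.ofReal_mul hδ, ← ENNReal.ofReal_add (F.re_trace_nonneg σ S) (mul_nonneg hδ hs)]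
  refine ENNReal.ofReal_le_ofReal ?_
  rw [Matrix.sub_mul, Matrix.sub_mul, trace_sub, trace_sub, Matrix.smul_mul, Matrix.one_mul,
    trace_smul, Complex.sub_re, Complex.sub_re, Complex.smul_re, smul_eq_mul] at hp
  linarith

lemma dist_le_traceMeasure (F : Observable N Ω) (ρ : State N) :
    F.dist ρ ≤ ((N : ℝ≥0) + 1) • F.traceMeasure := by
  refine Measure.le_iff.2 fun S hS => ?_
  rw [Measure.smul_apply, traceMeasure_apply F hS, dist_apply _ _ hS, ENNReal.smul_def, smul_eq_mul]
  have hp := re_trace_mul_nonneg (posSemidef_smul_one_sub ρ.posSemidef.1 ρ.norm_apply_le)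
    (F.posSemidef S)
  have hN : (((N : ℝ≥0) + 1 : ℝ≥0) : ℝ≥0∞) = ENNReal.ofReal ((N : ℝ) + 1) := by
    rw [ENNReal.ofReal_add (by positivity) (by positivity)]
    simp
  rw [hN, ← ENNReal.ofReal_mul (by positivity)]
  refine ENNReal.ofReal_le_ofReal ?_
  rw [Matrix.sub_mul, trace_sub, Matrix.smul_mul, Matrix.one_mul,
    trace_smul, Complex.sub_re, Complex.smul_re, smul_eq_mul] at hp
  linarith

end Observable

end

section

/-! ### The calibration error in terms of sharp states -/

variable {N : ℕ}

lemma isCompact_states (N : ℕ) : IsCompact {A : Op N | A.PosSemidef ∧ trace A = 1} := by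
  have hK : IsCompact (Set.pi Set.univ fun _ : Fin (N + 1) => Set.pi Set.univ
      fun _ : Fin (N + 1) => Metric.closedBall (0 : ℂ) 1) :=
    isCompact_univ_pi fun _ => isCompact_univ_pi fun _ => isCompact_closedBall _ _
  refine IsCompact.of_isClosed_subset hK ?_ ?_
  · have h1 : {A : Op N | A.PosSemidef ∧ trace A = 1} =
        ({A | Aᴴ = A} ∩ ⋂ x : Fin (N + 1) → ℂ, {A | 0 ≤ star x ⬝ᵥ A *ᵥ x}) ∩ {A | trace A = 1} := by
      ext A
      simp only [Set.mem_ofPred_eq, posSemidef_iff_dotProduct_mulVec, Set.mem_inter_iff,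
        Set.mem_iInter]
      rfl
    rw [h1]
    refine IsClosed.inter (IsClosed.inter ?_ (isClosed_iInter fun x => ?_)) ?_
    · exact isClosed_eq continuous_id.matrix_conjTranspose continuous_id
    · exact isClosed_le continuous_const
        (continuous_const.dotProduct (continuous_id.matrix_mulVec continuous_const))
    · exact isClosed_eq continuous_id.matrix_trace continuous_const
  · rintro A ⟨hA, ht⟩ j - k -
    simpa using State.norm_apply_le ⟨A, hA, ht⟩ j k

/-- The entrywise `ℓ¹` distance of two states. -/
def State.gap (ρ σ : State N) : ℝ := ∑ j, ∑ k, ‖ρ.toOp j k - σ.toOp j k‖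

namespace Observable

variable {X : Type*} [MetricSpace X] [MeasurableSpace X] {α : ℝ}

/-- All output distributions have finite moments of order `α`. -/
def HasMoments (α : ℝ) (F : Observable N X) : Prop :=
  ∀ (ρ : State N) (x : X), deviation α (F.dist ρ) x < ⊤

lemma HasMoments.lintegral_traceMeasure_lt_top {F : Observable N X} (hα : 0 < α)
    (hF : F.HasMoments α) (x : X) : ∫⁻ y, edist y x ^ α ∂F.traceMeasure < ⊤ := by
  rw [traceMeasure, lintegral_smul_measure, ← deviation_rpow hα, ENNReal.smul_def, smul_eq_mul]
  exact ENNReal.mul_lt_top ENNReal.coe_lt_top (ENNReal.rpow_lt_top_of_nonneg hα.le (hF _ _).ne)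

/-- When the trace measure has a finite moment, this gives continuity of `ρ ↦ deviation ^ α`. Weak
convergence of the output distributions would not suffice, because the cost is unbounded. -/
lemma deviation_rpow_le_add_gap (F : Observable N X) (hα : 0 < α) (ρ σ : State N) (x : X) :
    deviation α (F.dist ρ) x ^ α ≤ deviation α (F.dist σ) x ^ α +
      ENNReal.ofReal (((N : ℝ) + 1) * ρ.gap σ) * ∫⁻ y, edist y x ^ α ∂F.traceMeasure := by
  have hB : (ρ.toOp - σ.toOp).IsHermitian := ρ.posSemidef.1.sub σ.posSemidef.1
  have hgap : ∀ j k, ‖(ρ.toOp - σ.toOp) j k‖ ≤ ρ.gap σ := fun j k => by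
    refine le_trans ?_ (Finset.single_le_sum (f := fun j => ∑ k, ‖ρ.toOp j k - σ.toOp j k‖)
      (fun _ _ => Finset.sum_nonneg fun _ _ => norm_nonneg _) (Finset.mem_univ j))
    exact Finset.single_le_sum (f := fun k => ‖ρ.toOp j k - σ.toOp j k‖)
      (fun _ _ => norm_nonneg _) (Finset.mem_univ k)
  have h0 : 0 ≤ ((N : ℝ) + 1) * ρ.gap σ :=
    mul_nonneg (by positivity) ((norm_nonneg _).trans (hgap 0 0))
  have h := F.dist_le_add_smul ρ σ h0 (posSemidef_smul_one_sub hB hgap)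
  rw [deviation_rpow hα, deviation_rpow hα]
  refine (lintegral_mono' h le_rfl).trans_eq ?_
  rw [lintegral_add_measure, lintegral_smul_measure]
  rfl

end Observable

open Observable Filter

/-- If `E` and `F` have finite moments, then the calibration error is bounded by the worst case
deviation of `F` in the states in which `E` is sharp. -/
lemma calError_le_of_sharp {α : ℝ} (hα : 1 ≤ α) {F E : Observable N ℝ} (hF : F.HasMoments α)
    (hE : E.HasMoments α) {Δ : ℝ≥0∞}
    (h : ∀ ρ x, deviation α (E.dist ρ) x = 0 → deviation α (F.dist ρ) x ≤ Δ) :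
    calError α F E ≤ Δ := by
  have hα0 : 0 < α := by linarith
  by_contra! hlt
  obtain ⟨c, hc, hc'⟩ := exists_between hlt
  have hex : ∀ n : ℕ, ∃ (x : ℝ) (ρ : State N), deviation α (E.dist ρ) x ≤ ((n : ℝ≥0∞) + 1)⁻¹ ∧
      c < deviation α (F.dist ρ) x := fun n => by
    have h1 : c < calErrorAt α ((n : ℝ≥0∞) + 1)⁻¹ F E := hc'.trans_le
      (iInf₂_le _ (ENNReal.inv_pos.2 (ENNReal.add_ne_top.2 ⟨ENNReal.natCast_ne_top n,
        ENNReal.one_ne_top⟩)))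
    simp only [calErrorAt, lt_iSup_iff] at h1
    obtain ⟨x, ρ, hx, hxc⟩ := h1
    exact ⟨x, ρ, hx, hxc⟩
  choose x ρ hx hxc using hex
  set mE := fun x => ∫⁻ y, edist y x ^ α ∂E.traceMeasure with hmE
  set mF := fun x => ∫⁻ y, edist y x ^ α ∂F.traceMeasure with hmF
  have hmEfin : ∀ x, mE x < ⊤ := hE.lintegral_traceMeasure_lt_top hα0
  have hmFfin : ∀ x, mF x < ⊤ := hF.lintegral_traceMeasure_lt_top hα0
  -- The distribution of `E` is within deviation `1` of `x n`, and its deviation from `0` is bounded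
  -- uniformly in the state, so the points `x n` stay bounded.
  obtain ⟨R, hR⟩ : ∃ R : ℝ, ∀ n, x n ∈ Metric.closedBall (0 : ℝ) R := by
    have hB : ∀ n, edist (x n) 0 ≤ 1 + ((((N : ℝ≥0) + 1 : ℝ≥0) : ℝ≥0∞) * mE 0) ^ (1 / α) := by
      intro n
      refine (edist_le_deviation_add hα (E.dist (ρ n)) _ _).trans (add_le_add ?_ ?_)
      · exact (hx n).trans (ENNReal.inv_le_one.2 le_add_self)
      · refine ENNReal.rpow_le_rpow ?_ (by positivity)
        refine (lintegral_mono' (E.dist_le_traceMeasure (ρ n)) le_rfl).trans_eq ?_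
        rw [lintegral_smul_measure]
        rfl
    have hfin : 1 + ((((N : ℝ≥0) + 1 : ℝ≥0) : ℝ≥0∞) * mE 0) ^ (1 / α) < ⊤ :=
      ENNReal.add_lt_top.2 ⟨ENNReal.one_lt_top, ENNReal.rpow_lt_top_of_nonneg (by positivity)
        (ENNReal.mul_lt_top ENNReal.coe_lt_top (hmEfin 0)).ne⟩
    refine ⟨ENNReal.toReal (1 + ((((N : ℝ≥0) + 1 : ℝ≥0) : ℝ≥0∞) * mE 0) ^ (1 / α)), fun n => ?_⟩
    rw [Metric.mem_closedBall, dist_edist]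
    exact ENNReal.toReal_mono hfin.ne (hB n)
  have hcpt := (isCompact_closedBall (0 : ℝ) R).prod (isCompact_states N)
  obtain ⟨⟨x₀, A⟩, ⟨-, hA, hAt⟩, hcl⟩ := hcpt.exists_mapClusterPt
    (f := (atTop : Filter ℕ)) (u := fun n => (x n, (ρ n).toOp))
    (le_principal_iff.2 (mem_map.2 (univ_mem' fun n =>
      ⟨hR n, (ρ n).posSemidef, (ρ n).trace_eq_one⟩)))
  obtain ⟨U, hU, hUlim⟩ := mapClusterPt_iff_ultrafilter.1 hcl
  set σ : State N := ⟨A, hA, hAt⟩ with hσ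
  have hUx : Tendsto x U (𝓝 x₀) := (continuous_fst.tendsto _).comp hUlim
  have hUρ : Tendsto (fun n => (ρ n).toOp) U (𝓝 A) := (continuous_snd.tendsto _).comp hUlim
  have hent : ∀ j k, Tendsto (fun n => (ρ n).toOp j k) U (𝓝 (A j k)) := fun j k =>
    ((continuous_apply_apply j k).tendsto A).comp hUρ
  have hgap : Tendsto (fun n => ENNReal.ofReal (((N : ℝ) + 1) * (ρ n).gap σ)) U (𝓝 0) := by
    have : Tendsto (fun n => ((N : ℝ) + 1) * (ρ n).gap σ) U (𝓝 (((N : ℝ) + 1) *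
        ∑ j, ∑ k, ‖A j k - σ.toOp j k‖)) := Tendsto.const_mul _ <|
      tendsto_finsetSum _ fun j _ => tendsto_finsetSum _ fun k _ =>
        ((hent j k).sub tendsto_const_nhds).norm
    simpa [hσ] using ENNReal.tendsto_ofReal this
  have hgap' : Tendsto (fun n => ENNReal.ofReal (((N : ℝ) + 1) * σ.gap (ρ n))) U (𝓝 0) := by
    refine hgap.congr fun n => ?_
    simp only [State.gap, norm_sub_rev]
  have hdist : Tendsto (fun n => edist (x n) x₀) U (𝓝 0) := by
    simpa using hUx.edist (tendsto_const_nhds (x := x₀))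
  have hinv : Tendsto (fun n : ℕ => ((n : ℝ≥0∞) + 1)⁻¹) U (𝓝 0) := by
    have : Tendsto (fun n : ℕ => ((n : ℝ≥0∞) + 1)⁻¹) atTop (𝓝 0) := by
      have := (tendsto_add_atTop_iff_nat 1).2 ENNReal.tendsto_inv_nat_nhds_zero
      simpa using this
    exact this.mono_left hU
  have hrpow : ∀ {f : ℕ → ℝ≥0∞} {a : ℝ≥0∞} {p : ℝ}, Tendsto f U (𝓝 a) →
      Tendsto (fun n => f n ^ p) U (𝓝 (a ^ p)) := fun hf =>
    (ENNReal.continuous_rpow_const.tendsto _).comp hf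
  -- Almost sharp states accumulate at an exactly sharp one: both the change of state and the change
  -- of point cost a vanishing amount.
  have hsharp : deviation α (E.dist σ) x₀ = 0 := by
    have hle : ∀ n : ℕ, deviation α (E.dist σ) x₀ ^ α ≤ (((n : ℝ≥0∞) + 1)⁻¹ + edist (x n) x₀) ^ α +
        ENNReal.ofReal (((N : ℝ) + 1) * σ.gap (ρ n)) * mE x₀ := fun n => by
      refine (E.deviation_rpow_le_add_gap hα0 σ (ρ n) x₀).trans ?_
      gcongr
      exact (deviation_le_add_edist hα _ _ (x n)).trans (add_le_add (hx n) le_rfl)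
    have hlim : Tendsto (fun n : ℕ => (((n : ℝ≥0∞) + 1)⁻¹ + edist (x n) x₀) ^ α +
        ENNReal.ofReal (((N : ℝ) + 1) * σ.gap (ρ n)) * mE x₀) U (𝓝 0) := by
      have := (hrpow (p := α) (hinv.add hdist)).add
        (ENNReal.Tendsto.mul_const hgap' (Or.inr (hmEfin x₀).ne))
      simpa [hα0] using this
    have := ge_of_tendsto' hlim hle
    simpa [hα0, hα0.not_gt] using this
  -- The same comparison for `F` in the opposite direction keeps the lower bound `c > Δ` in the
  -- limit, contradicting the assumption on sharp states.
  have hle : ∀ n, c ≤ (deviation α (F.dist σ) x₀ ^ α +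
      ENNReal.ofReal (((N : ℝ) + 1) * (ρ n).gap σ) * mF x₀) ^ α⁻¹ + edist (x n) x₀ := fun n => by
    refine (hxc n).le.trans ((deviation_le_add_edist hα _ _ x₀).trans ?_)
    rw [edist_comm]
    gcongr
    rw [ENNReal.le_rpow_inv_iff hα0]
    exact F.deviation_rpow_le_add_gap hα0 (ρ n) σ x₀
  have hlim : Tendsto (fun n : ℕ => (deviation α (F.dist σ) x₀ ^ α +
      ENNReal.ofReal (((N : ℝ) + 1) * (ρ n).gap σ) * mF x₀) ^ α⁻¹ + edist (x n) x₀) U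
      (𝓝 (deviation α (F.dist σ) x₀)) := by
    have := (hrpow (p := α⁻¹) ((tendsto_const_nhds (x := deviation α (F.dist σ) x₀ ^ α)).add
      (ENNReal.Tendsto.mul_const hgap (Or.inr (hmFfin x₀).ne)))).add hdist
    simpa [ENNReal.rpow_rpow_inv hα0.ne'] using this
  exact absurd ((ge_of_tendsto' hlim hle).trans (h σ x₀ hsharp)) (not_le.2 hc)

/-! ### Finite errors imply finite moments -/

/-- The convex combination of two states. -/
def State.mix (a b : ℝ≥0) (hab : a + b = 1) (ρ σ : State N) : State N where
  toOp := (a : ℝ) • ρ.toOp + (b : ℝ) • σ.toOp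
  posSemidef := (ρ.posSemidef.smul a.coe_nonneg).add (σ.posSemidef.smul b.coe_nonneg)
  trace_eq_one := by
    have h : ((a : ℝ) : ℂ) + ((b : ℝ) : ℂ) = 1 := by exact_mod_cast hab
    rw [trace_add, trace_smul, trace_smul, ρ.trace_eq_one, σ.trace_eq_one]
    simpa using h

lemma Observable.dist_state_mix {Ω : Type*} [MeasurableSpace Ω] (F : Observable N Ω) (a b : ℝ≥0)
    (hab : a + b = 1) (ρ σ : State N) :
    F.dist (ρ.mix a b hab σ) = a • F.dist ρ + b • F.dist σ := by
  ext S hS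
  rw [Measure.add_apply, Measure.smul_apply, Measure.smul_apply, dist_apply _ _ hS,
    dist_apply _ _ hS, dist_apply _ _ hS, State.mix, Matrix.add_mul, Matrix.smul_mul,
    Matrix.smul_mul, trace_add, trace_smul, trace_smul, Complex.add_re, Complex.smul_re,
    Complex.smul_re, smul_eq_mul, smul_eq_mul,
    ENNReal.ofReal_add (mul_nonneg a.coe_nonneg (re_trace_nonneg F ρ S))
      (mul_nonneg b.coe_nonneg (re_trace_nonneg F σ S)), ENNReal.ofReal_mul a.coe_nonneg,
    ENNReal.ofReal_mul b.coe_nonneg]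
  simp [ENNReal.smul_def]

/-- The calibration error only tests nearly sharp states, but a small admixture of an arbitrary
state `ρ` to a sharp one is still admissible. The deviation power is linear in the mixture, so its
finiteness passes to `ρ`. -/
lemma hasMoments_of_calError_lt_top {α : ℝ} (hα : 1 ≤ α) {F E : Observable N ℝ}
    (hE : E.HasMoments α) (hsharp : ∃ ρ x, deviation α (E.dist ρ) x = 0)
    (h : calError α F E < ⊤) : F.HasMoments α := by
  have hα0 : 0 < α := by linarith
  obtain ⟨ρ₀, x₀, h0⟩ := hsharp
  simp only [calError, iInf_lt_iff] at h
  obtain ⟨ε, hε, hfin⟩ := h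
  intro ρ x
  have hm : deviation α (E.dist ρ) x₀ ^ α ≠ ⊤ :=
    (ENNReal.rpow_lt_top_of_nonneg hα0.le (hE ρ x₀).ne).ne
  -- The weight `t` keeps the admixed contribution to `E` below `ε ^ α`; taking the minimum with `1`
  -- makes it a mixing weight.
  obtain ⟨t, ht, htm⟩ := ENNReal.exists_nnreal_pos_mul_lt hm
    (ENNReal.rpow_pos_of_nonneg hε hα0.le).ne'
  set s := min 1 t with hs
  have hs0 : s ≠ 0 := (lt_min one_pos ht).ne'
  have hab : (1 - s) + s = 1 := tsub_add_cancel_of_le (min_le_left _ _)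
  have hd : ∀ G : Observable N ℝ, ∀ y, deviation α (G.dist (ρ₀.mix _ _ hab ρ)) y ^ α =
      (1 - s : ℝ≥0) * deviation α (G.dist ρ₀) y ^ α + s * deviation α (G.dist ρ) y ^ α := by
    intro G y
    rw [deviation_rpow hα0, deviation_rpow hα0, deviation_rpow hα0, dist_state_mix,
      lintegral_add_measure, lintegral_smul_measure, lintegral_smul_measure]
    rfl
  have hle : deviation α (E.dist (ρ₀.mix _ _ hab ρ)) x₀ ≤ ε := by
    rw [← ENNReal.rpow_le_rpow_iff hα0, hd, h0, ENNReal.zero_rpow_of_pos hα0, mul_zero, zero_add]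
    refine le_trans ?_ htm.le
    gcongr
    exact min_le_right _ _
  have h1 : deviation α (F.dist (ρ₀.mix _ _ hab ρ)) x₀ < ⊤ := 
    (deviation_le_calErrorAt hle).trans_lt hfin
  have h2 : (s : ℝ≥0∞) * deviation α (F.dist ρ) x₀ ^ α < ⊤ :=
    (le_add_self.trans_eq (hd F x₀).symm).trans_lt (ENNReal.rpow_lt_top_of_nonneg hα0.le h1.ne)
  have h3 : deviation α (F.dist ρ) x₀ < ⊤ := by
    rw [lt_top_iff_ne_top]
    intro htop
    rw [htop, ENNReal.top_rpow_of_pos hα0, ENNReal.mul_top (by exact_mod_cast hs0)] at h2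
    exact lt_irrefl _ h2
  exact (deviation_le_add_edist hα _ _ x₀).trans_lt (ENNReal.add_lt_top.2 ⟨h3, edist_lt_top _ _⟩)

lemma hasMoments_of_metricError_lt_top {α : ℝ} (hα : 1 ≤ α) {F E : Observable N ℝ}
    (hE : E.HasMoments α) (h : metricError α F E < ⊤) : F.HasMoments α := fun ρ x =>
  (deviation_le_wasserstein_add hα _ (E.dist ρ) x).trans_lt (ENNReal.add_lt_top.2
    ⟨(le_iSup (fun ρ => wasserstein α (F.dist ρ) (E.dist ρ)) ρ).trans_lt h, hE ρ x⟩)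

/-! ### Spectral measures -/

/-- The finite set of values of the spectral measure `E^e`. -/
def spinSpectrum (N : ℕ) (e : E3) : Finset ℝ :=
  Finset.univ.image (LComp_isHermitian N e).eigenvalues

lemma spinObservable_dist_compl (e : E3) (ρ : State N) :
    (spinObservable N e).dist ρ (spinSpectrum N e : Set ℝ)ᶜ = 0 := by
  have hS : MeasurableSet (spinSpectrum N e : Set ℝ)ᶜ := (Finset.measurableSet _).compl
  rw [dist_apply _ _ hS]
  have : (spinObservable N e).toVectorMeasure (spinSpectrum N e : Set ℝ)ᶜ = 0 := by
    change (∑ i, VectorMeasure.dirac ((LComp_isHermitian N e).eigenvalues i) _) _ = _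
    rw [FunLike.coe_sum, Finset.sum_apply]
    exact Finset.sum_eq_zero fun i _ =>
      VectorMeasure.dirac_apply_of_notMem (by simp [spinSpectrum])
  simp [this]

lemma spinObservable_hasMoments {α : ℝ} (hα : 0 < α) (e : E3) :
    (spinObservable N e).HasMoments α := fun ρ =>
  deviation_lt_top_of_finset hα _ _ (spinObservable_dist_compl e ρ)

/-- Any eigenvector will do; the one with index `0` always exists. It is the sharp state needed in
`hasMoments_of_calError_lt_top`. -/
lemma exists_sharp (α : ℝ) (hα : 0 < α) (e : E3) :
    ∃ (ρ : State N) (x : ℝ), deviation α ((spinObservable N e).dist ρ) x = 0 := by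
  set hA := LComp_isHermitian N e with hAdef
  set v : Fin (N + 1) → Fin (N + 1) → ℂ := fun i => hA.eigenvectorBasis i with hv
  have horth : ∀ i, star (v 0) ⬝ᵥ v i = if (0 : Fin (N + 1)) = i then 1 else 0 := fun i => by
    have := orthonormal_iff_ite.1 hA.eigenvectorBasis.orthonormal 0 i
    rw [EuclideanSpace.inner_eq_star_dotProduct, dotProduct_comm] at this
    exact this
  let ρ : State N := ⟨vecMulVec (v 0) (star (v 0)), posSemidef_vecMulVec_self_star _, by
    rw [trace_vecMulVec, dotProduct_comm, horth, if_pos rfl]⟩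
  have hS : MeasurableSet ({hA.eigenvalues 0}ᶜ : Set ℝ) := (measurableSet_singleton _).compl
  have hz : (spinObservable N e).dist ρ {hA.eigenvalues 0}ᶜ = 0 := by
    rw [dist_apply _ _ hS]
    have : trace (ρ.toOp * (spinObservable N e).toVectorMeasure {hA.eigenvalues 0}ᶜ) = 0 := by
      change trace (ρ.toOp * (∑ i, VectorMeasure.dirac (hA.eigenvalues i)
        (vecMulVec (v i) (star (v i)))) _) = _
      rw [FunLike.coe_sum, Finset.sum_apply, Finset.mul_sum, trace_sum]
      refine Finset.sum_eq_zero fun i _ => ?_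
      by_cases hi : hA.eigenvalues i = hA.eigenvalues 0
      · rw [VectorMeasure.dirac_apply_of_notMem (by simpa using hi), mul_zero, trace_zero]
      · rw [VectorMeasure.dirac_apply_of_mem hS (by simpa using hi), vecMulVec_mul_vecMulVec,
          horth, if_neg (fun h => hi (by rw [h]))]
        simp
    simp [this]
  refine ⟨ρ, hA.eigenvalues 0, ?_⟩
  have : ∫⁻ y, edist y (hA.eigenvalues 0) ^ α ∂(spinObservable N e).dist ρ = 0 := by
    refine (lintegral_congr_ae (g := fun _ => 0) ?_).trans lintegral_zero
    refine (measure_eq_zero_iff_ae_notMem.1 hz).mono fun y hy => ?_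
    have : y = hA.eigenvalues 0 := by simpa using hy
    simp [this, hα]
  rw [deviation, this, ENNReal.zero_rpow_of_pos (by positivity)]

end

section

/-! ### Transport to finitely many points: Kantorovich duality -/

section Duality

variable {Ω ι : Type*} [MeasurableSpace Ω] [Fintype ι]

/-- A measurable partition of unity, that is, a plan for the transport from `Ω` to `ι`. -/
structure IsPlan (f : ι → Ω → ℝ) : Prop where
  measurable : ∀ i, Measurable (f i)
  nonneg : ∀ i y, 0 ≤ f i y
  sum_eq_one : ∀ y, ∑ i, f i y = 1

namespace IsPlan

variable {f g : ι → Ω → ℝ}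

lemma le_one (hf : IsPlan f) (i : ι) (y : Ω) : f i y ≤ 1 := by
  rw [← hf.sum_eq_one y]
  exact Finset.single_le_sum (f := fun i => f i y) (fun j _ => hf.nonneg j y) (Finset.mem_univ i)

lemma integrable_mul (hf : IsPlan f) {μ : Measure Ω} {c : Ω → ℝ} (hc : Integrable c μ) (i : ι) :
    Integrable (fun y => f i y * c y) μ :=
  hc.bdd_mul (c := 1) (hf.measurable i).aestronglyMeasurable (Filter.Eventually.of_forall fun y => by
    rw [Real.norm_of_nonneg (hf.nonneg i y)]
    exact hf.le_one i y)

lemma integrable (hf : IsPlan f) (μ : Measure Ω) [IsFiniteMeasure μ] (i : ι) :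
    Integrable (f i) μ := by
  simpa using hf.integrable_mul (integrable_const (μ := μ) (1 : ℝ)) i

lemma mix (hf : IsPlan f) (hg : IsPlan g) {a b : ℝ} (ha : 0 ≤ a) (hb : 0 ≤ b) (hab : a + b = 1) :
    IsPlan fun i y => a * f i y + b * g i y where
  measurable i := ((hf.measurable i).const_mul a).add ((hg.measurable i).const_mul b)
  nonneg i y := add_nonneg (mul_nonneg ha (hf.nonneg i y)) (mul_nonneg hb (hg.nonneg i y))
  sum_eq_one y := by
    rw [Finset.sum_add_distrib, ← Finset.mul_sum, ← Finset.mul_sum, hf.sum_eq_one, hg.sum_eq_one,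
      mul_one, mul_one, hab]

lemma const {r : ι → ℝ} (hr : ∀ i, 0 ≤ r i) (h1 : ∑ i, r i = 1) :
    IsPlan fun i (_ : Ω) => r i :=
  ⟨fun _ => measurable_const, fun i _ => hr i, fun _ => h1⟩

lemma integral_mix_mul (hf : IsPlan f) (hg : IsPlan g) {μ : Measure Ω} {c : Ω → ℝ}
    (hc : Integrable c μ) (a b : ℝ) (i : ι) :
    ∫ y, (a * f i y + b * g i y) * c y ∂μ = a * ∫ y, f i y * c y ∂μ + b * ∫ y, g i y * c y ∂μ := by
  rw [← integral_const_mul, ← integral_const_mul, ← integral_add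
    ((hf.integrable_mul hc i).const_mul a) ((hg.integrable_mul hc i).const_mul b)]
  congr 1
  ext y
  ring

lemma integral_mix (hf : IsPlan f) (hg : IsPlan g) (μ : Measure Ω) [IsFiniteMeasure μ] (a b : ℝ)
    (i : ι) : ∫ y, a * f i y + b * g i y ∂μ = a * ∫ y, f i y ∂μ + b * ∫ y, g i y ∂μ := by
  simpa using hf.integral_mix_mul hg (integrable_const (μ := μ) (1 : ℝ)) a b i

lemma sum_integral (hf : IsPlan f) (μ : Measure Ω) [IsProbabilityMeasure μ] :
    ∑ i, ∫ y, f i y ∂μ = 1 := by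
  rw [← integral_finsetSum _ fun i _ => hf.integrable μ i]
  simp [hf.sum_eq_one]

end IsPlan

/-- The set of pairs (target weights, upper bound for the cost) of transport plans. -/
def planSet (μ : Measure Ω) (c : ι → Ω → ℝ) : Set ((ι → ℝ) × ℝ) :=
  {z | ∃ f, IsPlan f ∧ (∀ i, ∫ y, f i y ∂μ = z.1 i) ∧ ∑ i, ∫ y, f i y * c i y ∂μ ≤ z.2}

variable {μ : Measure Ω} [IsProbabilityMeasure μ] {c : ι → Ω → ℝ}

lemma convex_planSet (hc : ∀ i, Integrable (c i) μ) : Convex ℝ (planSet μ c) := by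
  rintro z ⟨f, hf, hf1, hf2⟩ w ⟨g, hg, hg1, hg2⟩ a b ha hb hab
  refine ⟨_, hf.mix hg ha hb hab, fun i => ?_, ?_⟩
  · rw [hf.integral_mix hg, hf1, hg1]
    rfl
  · simp only [hf.integral_mix_mul hg (hc _)]
    rw [Finset.sum_add_distrib, ← Finset.mul_sum, ← Finset.mul_sum]
    exact add_le_add (mul_le_mul_of_nonneg_left hf2 ha) (mul_le_mul_of_nonneg_left hg2 hb)

/-- If the pair `(p, K)` lay outside the closed convex set, a functional `(q, k) ↦ ∑ w i q i - l k`
would separate it strictly. After a shift and rescaling, `w` becomes a nonnegative dual variable `u`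
that contradicts `h`. -/
lemma mem_closure_planSet [DecidableEq ι] (hc : ∀ i, Integrable (c i) μ) {p : ι → ℝ}
    (hp : ∀ i, 0 ≤ p i) (hp1 : ∑ i, p i = 1) {K : ℝ}
    (h : ∀ u : ι → ℝ, (∀ i, 0 ≤ u i) → ∃ f, IsPlan f ∧
      ∑ i, ∫ y, f i y * c i y ∂μ + ∑ i, u i * ∫ y, f i y ∂μ ≤ K + ∑ i, u i * p i) :
    (p, K) ∈ closure (planSet μ c) := by
  by_contra hmem
  obtain ⟨φ, s, hφ, hs⟩ := geometric_hahn_banach_closed_point (convex_planSet hc).closure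
    isClosed_closure hmem
  set w : ι → ℝ := fun i => φ (Pi.single i 1, 0) with hw
  set l : ℝ := - φ (0, 1) with hl
  have hφ_eq : ∀ (q : ι → ℝ) (k : ℝ), φ (q, k) = ∑ i, w i * q i - l * k := fun q k => by
    have : (q, k) = ∑ i, q i • ((Pi.single i 1, 0) : (ι → ℝ) × ℝ) + k • ((0, 1) : (ι → ℝ) × ℝ) := by
      refine Prod.ext ?_ ?_
      · ext j
        simp [Prod.fst_sum, Finset.sum_apply, Pi.single_apply]
      · simp [Prod.snd_sum]
    rw [this, map_add, map_sum, map_smul]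
    simp only [map_smul, smul_eq_mul, hw, hl]
    simp only [mul_comm]
    ring
  have hlt : ∀ f, IsPlan f → ∀ k, ∑ i, ∫ y, f i y * c i y ∂μ ≤ k →
      ∑ i, w i * ∫ y, f i y ∂μ - l * k < ∑ i, w i * p i - l * K := fun f hf k hk => by
    rw [← hφ_eq (fun i => ∫ y, f i y ∂μ), ← hφ_eq]
    exact (hφ _ (subset_closure ⟨f, hf, fun _ => rfl, hk⟩)).trans hs
  have hne : Nonempty ι := by
    by_contra hcon
    rw [not_nonempty_iff] at hcon
    simp at hp1
  obtain ⟨i₀, hi₀⟩ := Finite.exists_max w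
  have hwp : ∑ i, w i * p i ≤ w i₀ := by
    calc ∑ i, w i * p i ≤ ∑ i, w i₀ * p i :=
          Finset.sum_le_sum fun i _ => mul_le_mul_of_nonneg_right (hi₀ i) (hp i)
      _ = w i₀ := by rw [← Finset.mul_sum, hp1, mul_one]
  have hf₀ : IsPlan fun i (_ : Ω) => (Pi.single i₀ 1 : ι → ℝ) i :=
    IsPlan.const (fun i => by by_cases hi : i = i₀ <;> simp [hi]) (by simp)
  have hlt₀ := hlt _ hf₀
  have hw₀ : ∑ i, w i * ∫ _ : Ω, (Pi.single i₀ 1 : ι → ℝ) i ∂μ = w i₀ := by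
    simp [Pi.single_apply]
  rw [hw₀] at hlt₀
  -- The bound on the cost may be raised freely, so a negative `l` would violate the separation.
  have hl0 : 0 ≤ l := by
    by_contra hneg
    push Not at hneg
    set S := ∑ i, ∫ y, (Pi.single i₀ 1 : ι → ℝ) i * c i y ∂μ
    have h1 := hlt₀ (max S K) (le_max_left _ _)
    have h2 : l * max S K ≤ l * K := mul_le_mul_of_nonpos_left (le_max_right _ _) hneg.le
    linarith
  -- A vertical functional (`l = 0`) is ruled out by the plan sending everything to `i₀`, whose
  -- value `w i₀` is at least `∑ w i p i`.
  rcases hl0.eq_or_lt with hl0 | hl0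
  · have := hlt₀ _ le_rfl
    rw [← hl0] at this
    linarith
  -- Adding a constant to `w` does not matter because both sets of weights sum to `1`; subtracting
  -- from the maximum makes the dual variable nonnegative.
  · obtain ⟨f, hf, hfK⟩ := h (fun i => (w i₀ - w i) / l)
      (fun i => div_nonneg (sub_nonneg.2 (hi₀ i)) hl0.le)
    have h1 := hlt f hf _ le_rfl
    have h2 : ∀ q : ι → ℝ, ∑ i, q i = 1 →
        l * ∑ i, (w i₀ - w i) / l * q i = w i₀ - ∑ i, w i * q i := fun q hq => by
      calc l * ∑ i, (w i₀ - w i) / l * q i = ∑ i, (w i₀ * q i - w i * q i) := by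
            rw [Finset.mul_sum]
            refine Finset.sum_congr rfl fun i _ => ?_
            field_simp
        _ = _ := by rw [Finset.sum_sub_distrib, ← Finset.mul_sum, hq, mul_one]
    have h3 := mul_le_mul_of_nonneg_left hfK hl0.le
    rw [mul_add, mul_add, h2 _ (hf.sum_integral μ), h2 _ hp1] at h3
    linarith

/-- Strong duality for the transport to finitely many points. -/
lemma exists_plan (hc : ∀ i, Integrable (c i) μ) (hc0 : ∀ i y, 0 ≤ c i y) {p : ι → ℝ}
    (hp : ∀ i, 0 < p i) (hp1 : ∑ i, p i = 1) {K : ℝ}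
    (h : ∀ u : ι → ℝ, (∀ i, 0 ≤ u i) → ∃ f, IsPlan f ∧
      ∑ i, ∫ y, f i y * c i y ∂μ + ∑ i, u i * ∫ y, f i y ∂μ ≤ K + ∑ i, u i * p i)
    {ε : ℝ} (hε : 0 < ε) :
    ∃ f, IsPlan f ∧ (∀ i, ∫ y, f i y ∂μ = p i) ∧ ∑ i, ∫ y, f i y * c i y ∂μ ≤ K + ε := by
  classical
  have hmem := mem_closure_planSet hc (fun i => (hp i).le) hp1 h
  have hne : Nonempty ι := by
    by_contra hcon
    rw [not_nonempty_iff] at hcon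
    simp at hp1
  obtain ⟨i₀, hi₀⟩ := Finite.exists_min p
  set M := ∑ i, ∫ y, c i y ∂μ with hM
  have hcI : ∀ i, 0 ≤ ∫ y, c i y ∂μ := fun i => integral_nonneg (hc0 i)
  have hM0 : 0 ≤ M := Finset.sum_nonneg fun i _ => hcI i
  -- The weight of a correction plan that restores the target weights exactly; its cost is at most
  -- `t * M ≤ ε / 2`.
  set t := min (1 / 2) (ε / (2 * (M + 1))) with ht
  have ht0 : 0 < t := by positivity
  have ht1 : t ≤ 1 / 2 := min_le_left _ _
  have htM : t * M ≤ ε / 2 := by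
    have : t ≤ ε / (2 * (M + 1)) := min_le_right _ _
    rw [le_div_iff₀ (by positivity)] at this
    nlinarith
  set η := min (ε / 2) (t * p i₀) with hη
  have hη0 : 0 < η := lt_min (by positivity) (mul_pos ht0 (hp i₀))
  obtain ⟨⟨q, k⟩, ⟨f, hf, hfq, hfk⟩, hd⟩ := Metric.mem_closure_iff.1 hmem η hη0
  rw [Prod.dist_eq, max_lt_iff] at hd
  have hq : ∀ i, q i ≤ p i + t * p i := fun i => by
    have h1 : dist (p i) (q i) < η := (dist_le_pi_dist p q i).trans_lt hd.1
    rw [Real.dist_eq, abs_lt] at h1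
    have h2 : η ≤ t * p i := (min_le_right _ _).trans (mul_le_mul_of_nonneg_left (hi₀ i) ht0.le)
    linarith
  have hk : k ≤ K + ε / 2 := by
    have h1 := hd.2
    rw [Real.dist_eq, abs_lt] at h1
    have h2 : η ≤ ε / 2 := min_le_left _ _
    linarith
  have hq1 : ∑ i, q i = 1 := by
    rw [← hf.sum_integral μ]
    exact Finset.sum_congr rfl fun i _ => (hfq i).symm
  -- This solves `p = (1 - t) q + t r`. Nonnegativity follows from `q i ≤ (1 + t) p i`, since `(1 -
  -- t) (1 + t) ≤ 1`; positivity of all `p i` provides room for this approximation.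
  set r : ι → ℝ := fun i => (p i - (1 - t) * q i) / t with hr
  have hr0 : ∀ i, 0 ≤ r i := fun i => by
    refine div_nonneg ?_ ht0.le
    nlinarith [hq i, hp i, mul_pos ht0 (hp i), mul_nonneg ht0.le (mul_pos ht0 (hp i)).le]
  have hr1 : ∑ i, r i = 1 := by
    rw [hr, ← Finset.sum_div, Finset.sum_sub_distrib, ← Finset.mul_sum, hp1, hq1]
    field_simp
    ring
  have hrle : ∀ i, r i ≤ 1 := fun i => by
    rw [← hr1]
    exact Finset.single_le_sum (fun j _ => hr0 j) (Finset.mem_univ i)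
  have hg : IsPlan fun i (_ : Ω) => r i := IsPlan.const hr0 hr1
  refine ⟨_, hf.mix hg (by linarith) ht0.le (sub_add_cancel 1 t), fun i => ?_, ?_⟩
  · rw [hf.integral_mix hg, hfq]
    simp only [integral_const, probReal_univ, one_smul, hr]
    field_simp
    ring
  · simp only [hf.integral_mix_mul hg (hc _)]
    rw [Finset.sum_add_distrib, ← Finset.mul_sum, ← Finset.mul_sum]
    simp only [integral_const_mul]
    have h1 : ∑ i, r i * ∫ y, c i y ∂μ ≤ M := Finset.sum_le_sum fun i _ =>
      mul_le_of_le_one_left (hcI i) (hrle i)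
    have h2 : 0 ≤ ∑ i, ∫ y, f i y * c i y ∂μ := Finset.sum_nonneg fun i _ =>
      integral_nonneg fun y => mul_nonneg (hf.nonneg i y) (hc0 i y)
    have h3 := mul_le_mul_of_nonneg_left h1 ht0.le
    nlinarith

/-- The plan which sends every point to the targets of minimal cost. -/
lemma exists_plan_iInf [Nonempty ι] {g : ι → Ω → ℝ≥0∞} (hg : ∀ i, Measurable (g i)) :
    ∃ f : ι → Ω → ℝ, IsPlan f ∧ ∀ y, ∑ i, ENNReal.ofReal (f i y) * g i y = ⨅ i, g i y := by
  classical
  -- Sharing the mass equally among all minimizers gives a measurable plan without a choice among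
  -- ties.
  set n : ι → Ω → ℝ := fun i y => if g i y = ⨅ j, g j y then 1 else 0 with hn
  have hn0 : ∀ i y, 0 ≤ n i y := fun i y => by simp only [hn]; split_ifs <;> norm_num
  have hpos : ∀ y, 0 < ∑ i, n i y := fun y => by
    obtain ⟨i, hi⟩ := exists_eq_ciInf_of_finite (f := fun j => g j y)
    refine Finset.sum_pos' (fun i _ => hn0 i y) ⟨i, Finset.mem_univ i, ?_⟩
    simp only [hn]
    rw [if_pos hi]
    exact one_pos
  have hmeas : ∀ i, Measurable (n i) := fun i =>
    Measurable.ite (measurableSet_eq_fun (hg i) (Measurable.iInf hg)) measurable_const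
      measurable_const
  have hplan : IsPlan fun i y => n i y / ∑ j, n j y :=
    ⟨fun i => (hmeas i).div (Finset.measurable_sum _ fun j _ => hmeas j),
      fun i y => div_nonneg (hn0 i y) (hpos y).le,
      fun y => by rw [← Finset.sum_div, div_self (hpos y).ne']⟩
  refine ⟨_, hplan, fun y => ?_⟩
  have : ∀ i, ENNReal.ofReal (n i y / ∑ j, n j y) * g i y =
      ENNReal.ofReal (n i y / ∑ j, n j y) * ⨅ j, g j y := fun i => by
    by_cases hi : g i y = ⨅ j, g j y
    · rw [← hi]
    · simp [hn, hi]
  simp only [this]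
  rw [← Finset.sum_mul, ← ENNReal.ofReal_sum_of_nonneg fun i _ => hplan.nonneg i y,
    hplan.sum_eq_one, ENNReal.ofReal_one, one_mul]

end Duality

end

section

/-! ### Duality for the Wasserstein distance to a finitely supported measure -/

section

variable {X : Type*} [MetricSpace X] [MeasurableSpace X] [OpensMeasurableSpace X]
  [SecondCountableTopology X] {α : ℝ}

lemma eq_sum_dirac_of_finset (ν : Measure X) (s : Finset X) (hs : ν (s : Set X)ᶜ = 0) :
    ν = ∑ a : s, ν {(a : X)} • Measure.dirac (a : X) := by
  ext S hS
  rw [Measure.finsetSum_apply]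
  have h1 : ν S = ν (S ∩ s) := by
    refine measure_congr ?_
    refine (measure_eq_zero_iff_ae_notMem.1 hs).mono fun y hy => ?_
    have hy' : y ∈ (s : Set X) := by simpa using hy
    refine propext ⟨fun h => ⟨h, hy'⟩, fun h => h.1⟩
  classical
  have h2 : S ∩ s = ((s.filter (· ∈ S) : Finset X) : Set X) := by
    ext y; simp [and_comm]
  rw [h1, h2, ← sum_measure_singleton, Finset.sum_filter, ← Finset.sum_coe_sort s]
  refine Finset.sum_congr rfl fun a _ => ?_
  rw [Measure.smul_apply, Measure.dirac_apply' _ hS, smul_eq_mul]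
  by_cases ha : (a : X) ∈ S <;> simp [ha]

/-- Weak duality: the dual functional is a lower bound for the cost of every coupling. -/
lemma lintegral_iInf_le_wasserstein (hα : 0 < α) (μ ν : Measure X) (s : Finset X)
    (hs : ν (s : Set X)ᶜ = 0) (u : s → ℝ≥0) :
    ∫⁻ y, ⨅ a : s, (edist y a ^ α + u a) ∂μ ≤ wasserstein α μ ν ^ α + ∑ a, u a * ν {(a : X)} := by
  refine ENNReal.le_of_forall_pos_le_add fun ε hε hfin => ?_
  have hW : wasserstein α μ ν ^ α ≠ ⊤ := (ENNReal.add_lt_top.1 hfin).1.ne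
  obtain ⟨γ, rfl, rfl, hγ⟩ := exists_coupling_of_wasserstein_rpow_lt hα
    (ENNReal.lt_add_right hW (by exact_mod_cast hε.ne' : (ε : ℝ≥0∞) ≠ 0))
  set U : X → ℝ≥0∞ := fun x => ∑ a : s, Set.indicator {(a : X)} (fun _ => (u a : ℝ≥0∞)) x with hU
  have hUm : Measurable U := Finset.measurable_sum _ fun a _ =>
    measurable_const.indicator (measurableSet_singleton _)
  have hcost : Measurable fun p : X × X => edist p.1 p.2 ^ α :=
    (measurable_fst.edist measurable_snd).pow_const α
  have hφ : Measurable fun y : X => ⨅ a : s, (edist y a ^ α + u a) :=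
    Measurable.iInf fun a => (measurable_edist_rpow (a : X)).add_const _
  have hUint : ∫⁻ x, U x ∂γ.map Prod.snd = ∑ a, u a * (γ.map Prod.snd) {(a : X)} := by
    rw [lintegral_finsetSum _ fun a _ => measurable_const.indicator (measurableSet_singleton _)]
    refine Finset.sum_congr rfl fun a _ => ?_
    rw [lintegral_indicator_const (measurableSet_singleton _)]
  rw [lintegral_map hφ measurable_fst]
  have hae : ∀ᵐ p ∂γ, p.2 ∈ s := by
    rw [Measure.map_apply measurable_snd s.measurableSet.compl] at hs
    exact (measure_eq_zero_iff_ae_notMem.1 hs).mono fun p hp => by simpa using hp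
  calc ∫⁻ p, ⨅ a : s, (edist p.1 (a : X) ^ α + u a) ∂γ
      ≤ ∫⁻ p, (edist p.1 p.2 ^ α + U p.2) ∂γ := by
        refine lintegral_mono_ae (hae.mono fun p hp => ?_)
        refine (iInf_le _ (⟨p.2, hp⟩ : s)).trans (add_le_add le_rfl ?_)
        exact le_trans (by simp) (Finset.single_le_sum (f := fun a : s => Set.indicator {(a : X)}
          (fun _ => (u a : ℝ≥0∞)) p.2) (fun _ _ => zero_le) (Finset.mem_univ ⟨p.2, hp⟩))
    _ = ∫⁻ p, edist p.1 p.2 ^ α ∂γ + ∑ a, u a * (γ.map Prod.snd) {(a : X)} := by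
        rw [lintegral_add_left hcost, ← hUint, lintegral_map hUm measurable_snd]
    _ ≤ wasserstein α (γ.map Prod.fst) (γ.map Prod.snd) ^ α + ε +
        ∑ a, u a * (γ.map Prod.snd) {(a : X)} := by gcongr
    _ = _ := by ring

/-- The cost of the coupling of a transport plan. -/
lemma wasserstein_rpow_le_of_isPlan (hα : 0 < α) (μ ν : Measure X) (s : Finset X)
    (hs : ν (s : Set X)ᶜ = 0) {f : s → X → ℝ} (hf : IsPlan f)
    (hfν : ∀ a, ∫⁻ y, ENNReal.ofReal (f a y) ∂μ = ν {(a : X)}) :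
    wasserstein α μ ν ^ α ≤ ∑ a, ∫⁻ y, ENNReal.ofReal (f a y) * edist y a ^ α ∂μ := by
  set κ : s → Measure X := fun a => μ.withDensity fun y => ENNReal.ofReal (f a y) with hκ
  have hfm : ∀ a, Measurable fun y => ENNReal.ofReal (f a y) := fun a =>
    (hf.measurable a).ennreal_ofReal
  have hpair : ∀ a : s, Measurable fun y : X => (y, (a : X)) := fun a =>
    measurable_id.prodMk measurable_const
  have hcost : Measurable fun p : X × X => edist p.1 p.2 ^ α :=
    (measurable_fst.edist measurable_snd).pow_const α
  refine (wasserstein_rpow_le hα (γ := ∑ a, (κ a).map fun y => (y, (a : X))) ?_ ?_).trans_eq ?_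
  · ext S hS
    rw [Measure.map_apply measurable_fst hS, Measure.finsetSum_apply]
    have : ∀ a : s, ((κ a).map fun y => (y, (a : X))) (Prod.fst ⁻¹' S) =
        ∫⁻ y in S, ENNReal.ofReal (f a y) ∂μ := fun a => by
      rw [Measure.map_apply (hpair a) (measurable_fst hS), ← withDensity_apply _ hS]
      rfl
    simp only [this]
    rw [← lintegral_finsetSum _ fun a _ => hfm a]
    simp only [← ENNReal.ofReal_sum_of_nonneg fun a _ => hf.nonneg a _, hf.sum_eq_one]
    simp
  · conv_rhs => rw [eq_sum_dirac_of_finset ν s hs]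
    ext S hS
    rw [Measure.map_apply measurable_snd hS, Measure.finsetSum_apply, Measure.finsetSum_apply]
    refine Finset.sum_congr rfl fun a _ => ?_
    rw [Measure.map_apply (hpair a) (measurable_snd hS), Measure.smul_apply,
      Measure.dirac_apply' _ hS, smul_eq_mul]
    by_cases ha : (a : X) ∈ S
    · have : (fun y : X => (y, (a : X))) ⁻¹' (Prod.snd ⁻¹' S) = Set.univ := by
        ext y; simp [ha]
      rw [this, hκ, withDensity_apply _ MeasurableSet.univ, setLIntegral_univ, hfν]
      simp [ha]
    · have : (fun y : X => (y, (a : X))) ⁻¹' (Prod.snd ⁻¹' S) = ∅ := by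
        ext y; simp [ha]
      rw [this]
      simp [ha]
  · rw [lintegral_finsetSum_measure]
    refine Finset.sum_congr rfl fun a _ => ?_
    rw [lintegral_map hcost (hpair a),
      lintegral_withDensity_eq_lintegral_mul _ (hfm a) (measurable_edist_rpow (a : X))]
    rfl

/-- For each `u`, the plan of `exists_plan_iInf` for the cost `d^α + u` realizes the dual integrand,
so the hypothesis is exactly what `exists_plan` needs. Finite moments permit the passage to real
integrals, and the positive atoms are the positive target weights. -/
lemma wasserstein_rpow_le_of_dual_aux (hα : 0 < α) (μ ν : Measure X) [IsProbabilityMeasure μ]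
    [IsProbabilityMeasure ν] (s : Finset X) (hs : ν (s : Set X)ᶜ = 0) (hpos : ∀ a ∈ s, ν {a} ≠ 0)
    (hμ : ∀ x, deviation α μ x < ⊤) (K : ℝ≥0)
    (h : ∀ u : s → ℝ≥0, ∫⁻ y, ⨅ a : s, (edist y a ^ α + u a) ∂μ ≤ K + ∑ a, u a * ν {(a : X)}) :
    wasserstein α μ ν ^ α ≤ K := by
  have hcm : ∀ a : s, Measurable fun y : X => dist y (a : X) ^ α := fun a =>
    measurable_dist.comp (measurable_id.prodMk measurable_const) |>.pow_const α
  have hc0 : ∀ (a : s) (y : X), 0 ≤ dist y (a : X) ^ α := fun a y => by positivity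
  have hofReal : ∀ (a : s) (y : X), ENNReal.ofReal (dist y (a : X) ^ α) = edist y (a : X) ^ α :=
    fun a y => by rw [edist_dist, ENNReal.ofReal_rpow_of_nonneg dist_nonneg hα.le]
  have hc : ∀ a : s, Integrable (fun y : X => dist y (a : X) ^ α) μ := fun a => by
    refine ⟨(hcm a).aestronglyMeasurable, ?_⟩
    rw [hasFiniteIntegral_iff_ofReal (Filter.Eventually.of_forall (hc0 a))]
    simp only [hofReal]
    rw [← deviation_rpow hα]
    exact ENNReal.rpow_lt_top_of_nonneg hα.le (hμ _).ne
  have hsum : ∑ a : s, ν {(a : X)} = 1 := by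
    have h1 := Finset.sum_coe_sort s fun a => ν {a}
    rw [h1, sum_measure_singleton]
    rw [prob_compl_eq_zero_iff s.measurableSet] at hs
    exact hs
  set p : s → ℝ := fun a => ν.real {(a : X)} with hp
  have hpν : ∀ a : s, ν {(a : X)} = ENNReal.ofReal (p a) := fun a => (ofReal_measureReal).symm
  have hp0 : ∀ a, 0 < p a := fun a =>
    ENNReal.toReal_pos (hpos a a.2) (measure_ne_top _ _)
  have hp1 : ∑ a, p a = 1 := by
    simp only [hp, Measure.real]
    rw [← ENNReal.toReal_sum fun _ _ => measure_ne_top _ _, hsum, ENNReal.toReal_one]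
  have hne : Nonempty s := by
    by_contra hcon
    rw [not_nonempty_iff] at hcon
    simp at hp1
  have hint : ∀ {f : s → X → ℝ}, IsPlan f → ∀ a, ∫⁻ y, ENNReal.ofReal (f a y) ∂μ =
      ENNReal.ofReal (∫ y, f a y ∂μ) := fun hf a =>
    (ofReal_integral_eq_lintegral_ofReal (hf.integrable μ a)
      (Filter.Eventually.of_forall (hf.nonneg a))).symm
  have hint' : ∀ {f : s → X → ℝ}, IsPlan f → ∀ a : s,
      ∫⁻ y, ENNReal.ofReal (f a y) * edist y (a : X) ^ α ∂μ =
      ENNReal.ofReal (∫ y, f a y * dist y (a : X) ^ α ∂μ) := fun hf a => by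
    rw [ofReal_integral_eq_lintegral_ofReal (hf.integrable_mul (hc a) a)
      (Filter.Eventually.of_forall fun y => mul_nonneg (hf.nonneg a y) (hc0 a y))]
    refine lintegral_congr fun y => ?_
    rw [ENNReal.ofReal_mul (hf.nonneg a y), hofReal]
  have hnn : ∀ {f : s → X → ℝ}, IsPlan f → ∀ a : s, 0 ≤ ∫ y, f a y * dist y (a : X) ^ α ∂μ :=
    fun hf a => integral_nonneg fun y => mul_nonneg (hf.nonneg a y) (hc0 a y)
  have hdual : ∀ u : s → ℝ, (∀ a, 0 ≤ u a) → ∃ f : s → X → ℝ, IsPlan f ∧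
      ∑ a : s, ∫ y, f a y * dist y (a : X) ^ α ∂μ + ∑ a, u a * ∫ y, f a y ∂μ ≤
        K + ∑ a, u a * p a := fun u hu => by
    obtain ⟨f, hf, hfmin⟩ := exists_plan_iInf (g := fun (a : s) (y : X) =>
      edist y (a : X) ^ α + (u a).toNNReal) fun a => (measurable_edist_rpow (a : X)).add_const _
    refine ⟨f, hf, ?_⟩
    have h1 := h fun a => (u a).toNNReal
    simp only [← hfmin] at h1
    have h4 : ∫⁻ y, ∑ a : s, ENNReal.ofReal (f a y) * (edist y (a : X) ^ α + (u a).toNNReal) ∂μ =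
        ∑ a : s, ∫⁻ y, ENNReal.ofReal (f a y) * (edist y (a : X) ^ α + (u a).toNNReal) ∂μ :=
      lintegral_finsetSum _ fun a _ => (hf.measurable a).ennreal_ofReal.mul
        ((measurable_edist_rpow (a : X)).add_const _)
    rw [h4] at h1
    have h2 : ∀ a : s, ∫⁻ y, ENNReal.ofReal (f a y) * (edist y (a : X) ^ α + (u a).toNNReal) ∂μ =
        ENNReal.ofReal (∫ y, f a y * dist y (a : X) ^ α ∂μ + u a * ∫ y, f a y ∂μ) := fun a => by
      simp only [mul_add]
      rw [lintegral_add_right _ ((hf.measurable a).ennreal_ofReal.mul_const _), hint' hf,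
        lintegral_mul_const _ (hf.measurable a).ennreal_ofReal, hint hf, mul_comm,
        ENNReal.ofReal_add (hnn hf a) (mul_nonneg (hu a) (integral_nonneg (hf.nonneg a))),
        ENNReal.ofReal_mul (hu a)]
      rfl
    have h3 : ∀ a : s, ((u a).toNNReal : ℝ≥0∞) * ν {(a : X)} = ENNReal.ofReal (u a * p a) :=
      fun a => by rw [ENNReal.ofReal_mul (hu a), ← hpν]; rfl
    have h0 : ∀ a : s, 0 ≤ ∫ y, f a y * dist y (a : X) ^ α ∂μ + u a * ∫ y, f a y ∂μ := fun a =>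
      add_nonneg (hnn hf a) (mul_nonneg (hu a) (integral_nonneg (hf.nonneg a)))
    have h0' : ∀ a : s, 0 ≤ u a * p a := fun a => mul_nonneg (hu a) (hp0 a).le
    simp only [h2, h3] at h1
    rw [← ENNReal.ofReal_sum_of_nonneg fun a _ => h0 a,
      ← ENNReal.ofReal_sum_of_nonneg fun a _ => h0' a, ← ENNReal.ofReal_coe_nnreal,
      ← ENNReal.ofReal_add K.coe_nonneg (Finset.sum_nonneg fun a _ => h0' a),
      ENNReal.ofReal_le_ofReal_iff (add_nonneg K.coe_nonneg (Finset.sum_nonneg fun a _ => h0' a)),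
      Finset.sum_add_distrib] at h1
    exact h1
  refine ENNReal.le_of_forall_pos_le_add fun ε hε _ => ?_
  obtain ⟨f, hf, hfp, hfK⟩ := exists_plan hc hc0 hp0 hp1 hdual (ε := ε) (by exact_mod_cast hε)
  refine (wasserstein_rpow_le_of_isPlan hα μ ν s hs hf fun a => ?_).trans ?_
  · rw [hint hf, hfp, hpν]
  · simp only [hint' hf]
    rw [← ENNReal.ofReal_sum_of_nonneg fun a _ => hnn hf a]
    refine (ENNReal.ofReal_le_ofReal hfK).trans_eq ?_
    rw [ENNReal.ofReal_add K.coe_nonneg ε.coe_nonneg, ENNReal.ofReal_coe_nnreal,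
      ENNReal.ofReal_coe_nnreal]

/-- The power of the Wasserstein distance to a finitely supported measure is convex: it does not
increase beyond the bound `K` when measures are averaged. -/
lemma wasserstein_bind_rpow_le {G : Type*} [MeasurableSpace G] (hα : 0 < α) (m : Measure G)
    [IsProbabilityMeasure m] {κ : G → Measure X} (hκ : Measurable κ) (ν : Measure X)
    [IsProbabilityMeasure (m.bind κ)] [IsProbabilityMeasure ν] (s : Finset X)
    (hs : ν (s : Set X)ᶜ = 0) (hfin : ∀ x, deviation α (m.bind κ) x < ⊤) (K : ℝ≥0)
    (h : ∀ g, wasserstein α (κ g) ν ^ α ≤ K) : wasserstein α (m.bind κ) ν ^ α ≤ K := by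
  classical
  -- Points of `s` without mass are discarded, as strong duality is applied with positive target
  -- weights.
  have hs' : ν ((s.filter fun a => ν {a} ≠ 0 : Finset X) : Set X)ᶜ = 0 := by
    have hsub : ((s.filter fun a => ν {a} ≠ 0 : Finset X) : Set X)ᶜ ⊆
        (s : Set X)ᶜ ∪ ⋃ a ∈ ((s.filter fun a => ν {a} = 0 : Finset X) : Set X), {a} := by
      intro y hy
      by_cases hys : y ∈ s
      · right
        have hy' : ν {y} = 0 := by
          by_contra hcon
          exact hy (by simp [hys, hcon])
        simp [hys, hy']
      · left
        simpa using hys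
    refine measure_mono_null hsub (measure_union_null hs ?_)
    rw [measure_biUnion_null_iff (Finset.finite_toSet _).countable]
    exact fun a ha => (Finset.mem_filter.1 ha).2
  refine wasserstein_rpow_le_of_dual_aux hα _ ν _ hs' (fun a ha => (Finset.mem_filter.1 ha).2)
    hfin K fun u => ?_
  have hm : Measurable fun y : X => ⨅ a : (s.filter fun a => ν {a} ≠ 0 : Finset X),
      (edist y (a : X) ^ α + u a) :=
    Measurable.iInf fun a => (measurable_edist_rpow (a : X)).add_const _
  -- The dual functional is linear in the first measure: weak duality is applied for each `g` and
  -- then integrated.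
  rw [Measure.lintegral_bind hκ.aemeasurable hm.aemeasurable]
  refine (lintegral_mono fun g => (lintegral_iInf_le_wasserstein hα (κ g) ν _ hs' u).trans
    (add_le_add (h g) le_rfl)).trans_eq ?_
  simp

end

end

section

/-! ### `SU(2)` as a compact group -/

instance : IsTopologicalGroup SU2 where
  continuous_mul := Continuous.subtype_mk
    ((continuous_subtype_val.comp continuous_fst).mul
      (continuous_subtype_val.comp continuous_snd)) _
  continuous_inv := Continuous.subtype_mk continuous_subtype_val.matrix_conjTranspose _

instance : CompactSpace SU2 := by
  refine isCompact_iff_compactSpace.1 ?_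
  have hK : IsCompact (Set.pi Set.univ fun _ : Fin 2 => Set.pi Set.univ
      fun _ : Fin 2 => Metric.closedBall (0 : ℂ) 1) :=
    isCompact_univ_pi fun _ => isCompact_univ_pi fun _ => isCompact_closedBall _ _
  refine IsCompact.of_isClosed_subset hK ?_ ?_
  · have : (SU2 : Set (Matrix (Fin 2) (Fin 2) ℂ)) = {A | A * Aᴴ = 1} ∩ {A | A.det = 1} := by
      ext A
      rw [SetLike.mem_coe, mem_specialUnitaryGroup_iff, mem_unitaryGroup_iff]
      rfl
    rw [this]
    exact (isClosed_eq (continuous_id.matrix_mul continuous_id.matrix_conjTranspose)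
      continuous_const).inter (isClosed_eq continuous_id.matrix_det continuous_const)
  · intro A hA j _ k _
    simpa using entry_norm_bound_of_unitary (mem_specialUnitaryGroup_iff.1 hA).1 j k

instance : MeasurableSpace SU2 := borel SU2

instance : BorelSpace SU2 := ⟨rfl⟩

/-- The normalized Haar measure of `SU(2)`. -/
def haarSU2 : Measure SU2 := Measure.haarMeasure ⊤

instance : IsProbabilityMeasure haarSU2 :=
  ⟨by simpa [haarSU2] using Measure.haarMeasure_self (K₀ := (⊤ : TopologicalSpace.PositiveCompacts SU2))⟩

instance : haarSU2.IsMulLeftInvariant := Measure.isMulLeftInvariant_haarMeasure _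

lemma continuous_coeff_mul {Y : Type*} [TopologicalSpace Y] {P Q : Y → ℂ[X]}
    (hP : ∀ j, Continuous fun y => (P y).coeff j) (hQ : ∀ j, Continuous fun y => (Q y).coeff j)
    (j : ℕ) : Continuous fun y => (P y * Q y).coeff j := by
  simp only [coeff_mul]
  exact continuous_finsetSum _ fun i _ => (hP i.1).mul (hQ i.2)

lemma continuous_coeff_pow {Y : Type*} [TopologicalSpace Y] {P : Y → ℂ[X]}
    (hP : ∀ j, Continuous fun y => (P y).coeff j) (n j : ℕ) :
    Continuous fun y => (P y ^ n).coeff j := by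
  induction n generalizing j with
  | zero => simpa using continuous_const
  | succ n ih =>
    simp only [pow_succ]
    exact continuous_coeff_mul ih hP j

lemma continuous_spinMatrix (N : ℕ) (j k : Fin (N + 1)) :
    Continuous fun A : Matrix (Fin 2) (Fin 2) ℂ => spinMatrix N A j k := by
  have hlin : ∀ a b : Fin 2 × Fin 2, ∀ j, Continuous fun A : Matrix (Fin 2) (Fin 2) ℂ =>
      (C (A a.1 a.2) + C (A b.1 b.2) * X : ℂ[X]).coeff j := by
    rintro a b (_ | _ | j)
    · simpa using continuous_id.matrix_elem a.1 a.2
    · simpa [coeff_C_succ] using continuous_id.matrix_elem b.1 b.2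
    · simpa [coeff_C_succ, coeff_X] using continuous_const
  exact continuous_const.mul (continuous_coeff_mul
    (continuous_coeff_pow (hlin (0, 0) (1, 0)) _) (continuous_coeff_pow (hlin (0, 1) (1, 1)) _) j)

lemma continuous_rot : Continuous fun p : SU2 × E3 => rot p.1 p.2 := by
  have hg : Continuous fun p : SU2 × E3 => p.1.1 := continuous_subtype_val.comp continuous_fst
  have h1 : Continuous fun p : SU2 × E3 => rotMatrix p.1 := by
    refine continuous_pi fun i => continuous_pi fun j => ?_
    refine Continuous.div_const (Complex.continuous_re.comp (Continuous.matrix_trace ?_)) 2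
    exact (((continuous_const.matrix_mul hg).matrix_mul continuous_const).matrix_mul
      hg.matrix_conjTranspose)
  exact (PiLp.continuous_toLp 2 _).comp (h1.matrix_mulVec
    ((PiLp.continuous_ofLp 2 _).comp continuous_snd))

/-! ### Averages of observables over the rotation group -/

variable {N : ℕ}

/-- The Jordan decomposition reduces this to measurability of the measures of sections of `f ⁻¹' S`.
It is applied to the real and imaginary parts of the entries of an observable. -/
lemma measurable_signedMeasure_preimage {Y Z : Type*} [MeasurableSpace Y] [MeasurableSpace Z]
    (s : SignedMeasure Z) {f : Y × Z → Z} (hf : Measurable f) {S : Set Z} (hS : MeasurableSet S) :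
    Measurable fun y => s ((fun z => f (y, z)) ⁻¹' S) := by
  have h : ∀ y, s ((fun z => f (y, z)) ⁻¹' S) =
      s.toJordanDecomposition.posPart.real (Prod.mk y ⁻¹' (f ⁻¹' S)) -
      s.toJordanDecomposition.negPart.real (Prod.mk y ⁻¹' (f ⁻¹' S)) := fun y => by
    have hm : MeasurableSet (Prod.mk y ⁻¹' (f ⁻¹' S)) := measurable_prodMk_left (hf hS)
    conv_lhs => rw [← s.toSignedMeasure_toJordanDecomposition]
    rw [JordanDecomposition.toSignedMeasure, _root_.sub_apply]
    change Measure.toSignedMeasure _ (Prod.mk y ⁻¹' (f ⁻¹' S)) - Measure.toSignedMeasure _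
      (Prod.mk y ⁻¹' (f ⁻¹' S)) = _
    rw [Measure.toSignedMeasure_apply_measurable hm, Measure.toSignedMeasure_apply_measurable hm]
  simp only [h]
  exact (measurable_measure_prodMk_left (hf hS)).ennreal_toReal.sub
    (measurable_measure_prodMk_left (hf hS)).ennreal_toReal

namespace Observable

lemma measurable_apply_preimage (F : Observable N E3) {S : Set E3} (hS : MeasurableSet S)
    (j k : Fin (N + 1)) : Measurable fun g => F.toVectorMeasure (rot g ⁻¹' S) j k := by
  let re : Op N →+ ℝ := ⟨⟨fun A => (A j k).re, by simp⟩, fun A B => by simp⟩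
  let im : Op N →+ ℝ := ⟨⟨fun A => (A j k).im, by simp⟩, fun A B => by simp⟩
  have hre : Continuous re := Complex.continuous_re.comp (continuous_apply_apply j k)
  have him : Continuous im := Complex.continuous_im.comp (continuous_apply_apply j k)
  have hr := continuous_rot.measurable
  have h1 := measurable_signedMeasure_preimage (F.toVectorMeasure.mapRange re hre) hr hS
  have h2 := measurable_signedMeasure_preimage (F.toVectorMeasure.mapRange im him) hr hS
  simp only [VectorMeasure.mapRange_apply] at h1 h2
  exact measurable_of_re_im h1 h2

lemma measurable_T_apply (F : Observable N E3) {S : Set E3} (hS : MeasurableSet S)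
    (j k : Fin (N + 1)) : Measurable fun g => (F.T g).toVectorMeasure S j k := by
  have hU : ∀ a b, Measurable fun g : SU2 => (spinRep N g).1 a b := fun a b =>
    ((continuous_spinMatrix N a b).comp continuous_subtype_val).measurable
  simp only [T_apply _ _ hS, Matrix.mul_apply, conjTranspose_apply]
  exact Finset.measurable_sum _ fun l _ => (Finset.measurable_sum _ fun m _ =>
    (hU j m).mul (F.measurable_apply_preimage hS m l)).mul
      (continuous_star.measurable.comp (hU k l))

variable {Ω : Type*} [MeasurableSpace Ω]

lemma re_trace_le (F : Observable N Ω) {S : Set Ω} (hS : MeasurableSet S) :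
    (trace (F.toVectorMeasure S)).re ≤ (N : ℝ) + 1 := by
  have h : F.traceMeasure S ≤ F.traceMeasure Set.univ := measure_mono (Set.subset_univ _)
  rw [traceMeasure_apply _ hS, traceMeasure_apply _ MeasurableSet.univ, F.normalized, trace_one,
    Fintype.card_fin] at h
  simpa using (ENNReal.ofReal_le_ofReal_iff (by simp; positivity)).1 h

lemma norm_apply_le (F : Observable N Ω) {S : Set Ω} (hS : MeasurableSet S)
    (j k : Fin (N + 1)) : ‖F.toVectorMeasure S j k‖ ≤ (N : ℝ) + 1 :=
  (norm_apply_le_trace (F.posSemidef S) j k).trans (F.re_trace_le hS)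

lemma integrable_T_apply (F : Observable N E3) {S : Set E3} (hS : MeasurableSet S)
    (j k : Fin (N + 1)) : Integrable (fun g => (F.T g).toVectorMeasure S j k) haarSU2 :=
  Integrable.of_bound (F.measurable_T_apply hS j k).aestronglyMeasurable ((N : ℝ) + 1)
    (Filter.Eventually.of_forall fun g => (F.T g).norm_apply_le hS j k)

/-- The average of `(T_g F)(S)` over the rotation group. -/
def averageOp (F : Observable N E3) (S : Set E3) : Op N :=
  Matrix.of fun j k => ∫ g, (F.T g).toVectorMeasure S j k ∂haarSU2

lemma mul_averageOp_mul_apply (F : Observable N E3) {S : Set E3} (hS : MeasurableSet S)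
    (A B : Op N) (j k : Fin (N + 1)) : (A * F.averageOp S * B) j k =
      ∫ g, (A * (F.T g).toVectorMeasure S * B) j k ∂haarSU2 := by
  simp only [Matrix.mul_apply]
  have hi := F.integrable_T_apply hS
  rw [integral_finsetSum _ fun l _ => (integrable_finsetSum _ fun m _ =>
    (hi m l).const_mul _).mul_const _]
  refine Finset.sum_congr rfl fun l _ => ?_
  rw [integral_mul_const, integral_finsetSum _ fun m _ => (hi m l).const_mul _]
  congr 1
  refine Finset.sum_congr rfl fun m _ => ?_
  rw [integral_const_mul]
  rfl

lemma measurable_trace_mul_T (F : Observable N E3) {S : Set E3} (hS : MeasurableSet S)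
    (A : Op N) : Measurable fun g => (trace (A * (F.T g).toVectorMeasure S)).re := by
  simp only [trace, diag_apply, Matrix.mul_apply]
  exact Complex.measurable_re.comp (Finset.measurable_sum _ fun l _ => Finset.measurable_sum _
    fun m _ => (F.measurable_T_apply hS m l).const_mul _)

lemma re_trace_mul_averageOp (F : Observable N E3) {S : Set E3} (hS : MeasurableSet S)
    (A : Op N) : (trace (A * F.averageOp S)).re =
      ∫ g, (trace (A * (F.T g).toVectorMeasure S)).re ∂haarSU2 := by
  have hi : ∀ l, Integrable (fun g => (A * (F.T g).toVectorMeasure S) l l) haarSU2 := fun l => by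
    simp only [Matrix.mul_apply]
    exact integrable_finsetSum _ fun m _ => (F.integrable_T_apply hS m l).const_mul _
  have h := fun l => F.mul_averageOp_mul_apply hS A 1 l l
  simp only [Matrix.mul_one] at h
  simp only [trace, diag_apply, h]
  rw [← integral_finsetSum _ fun l _ => hi l]
  exact (integral_re (𝕜 := ℂ) (integrable_finsetSum _ fun l _ => hi l)).symm

lemma averageOp_posSemidef (F : Observable N E3) {S : Set E3} (hS : MeasurableSet S) :
    (F.averageOp S).PosSemidef := by
  have hH : (F.averageOp S).IsHermitian := by
    ext j k
    rw [conjTranspose_apply]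
    change (starRingEnd ℂ) (∫ g, (F.T g).toVectorMeasure S k j ∂haarSU2) = _
    rw [← integral_conj]
    refine integral_congr_ae (Filter.Eventually.of_forall fun g => ?_)
    exact congrFun (congrFun ((F.T g).posSemidef S).1 j) k
  refine PosSemidef.of_dotProduct_mulVec_nonneg hH fun x => ?_
  rw [Complex.nonneg_iff]
  refine ⟨?_, (hH.im_star_dotProduct_mulVec_self x).symm⟩
  have h : star x ⬝ᵥ F.averageOp S *ᵥ x = trace (vecMulVec x (star x) * F.averageOp S) := by
    rw [vecMulVec_mul, trace_vecMulVec, dotProduct_mulVec, dotProduct_comm]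
  rw [h, re_trace_mul_averageOp F hS]
  exact integral_nonneg fun g => re_trace_mul_nonneg (posSemidef_vecMulVec_self_star x)
    ((F.T g).posSemidef S)

/-- Dominated convergence, entry by entry: the norms of the entries are bounded by traces, and the
traces sum to the trace on the union, at most `N + 1`. -/
lemma hasSum_averageOp (F : Observable N E3) {f : ℕ → Set E3} (hf : ∀ i, MeasurableSet (f i))
    (hd : Pairwise (Function.onFun Disjoint f)) :
    HasSum (fun i => F.averageOp (f i)) (F.averageOp (⋃ i, f i)) := by
  have hS : ∀ g, HasSum (fun i => (F.T g).toVectorMeasure (f i))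
      ((F.T g).toVectorMeasure (⋃ i, f i)) := fun g => (F.T g).toVectorMeasure.m_iUnion hf hd
  have hent : ∀ g j k, HasSum (fun i => (F.T g).toVectorMeasure (f i) j k)
      ((F.T g).toVectorMeasure (⋃ i, f i) j k) := fun g j k =>
    Pi.hasSum.1 (Pi.hasSum.1 (hS g) j) k
  have htr : ∀ g, HasSum (fun i => (trace ((F.T g).toVectorMeasure (f i))).re)
      (trace ((F.T g).toVectorMeasure (⋃ i, f i))).re := fun g => by
    simp only [trace, diag_apply, Complex.re_sum]
    exact hasSum_sum fun j _ => Complex.hasSum_re (hent g j j)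
  refine Pi.hasSum.2 fun j => Pi.hasSum.2 fun k => ?_
  refine hasSum_integral_of_dominated_convergence
    (fun i g => (trace ((F.T g).toVectorMeasure (f i))).re)
    (fun i => (F.measurable_T_apply (hf i) j k).aestronglyMeasurable)
    (fun i => Filter.Eventually.of_forall fun g => norm_apply_le_trace ((F.T g).posSemidef _) j k)
    (Filter.Eventually.of_forall fun g => (htr g).summable) ?_
    (Filter.Eventually.of_forall fun g => hent g j k)
  simp only [(htr _).tsum_eq]
  have hm := F.measurable_trace_mul_T (MeasurableSet.iUnion hf) 1
  simp only [Matrix.one_mul] at hm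
  refine Integrable.of_bound hm.aestronglyMeasurable ((N : ℝ) + 1)
    (Filter.Eventually.of_forall fun g => ?_)
  have h0 := re_trace_mul_nonneg PosSemidef.one ((F.T g).posSemidef (⋃ i, f i))
  rw [Matrix.one_mul] at h0
  rw [Real.norm_of_nonneg h0]
  exact (F.T g).re_trace_le (MeasurableSet.iUnion hf)

open Classical in
/-- The average of an observable over the rotation group. -/
def average (F : Observable N E3) : Observable N E3 where
  toVectorMeasure :=
    { measureOf' := fun S => if MeasurableSet S then F.averageOp S else 0
      empty' := by
        rw [if_pos MeasurableSet.empty]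
        ext j k
        simp [averageOp]
      not_measurable' := fun S hS => if_neg hS
      m_iUnion' := fun f hf hd => by
        rw [if_pos (MeasurableSet.iUnion hf)]
        simp only [hf, if_true]
        exact F.hasSum_averageOp hf hd }
  posSemidef S := by
    change (if MeasurableSet S then F.averageOp S else 0).PosSemidef
    split_ifs with hS
    · exact F.averageOp_posSemidef hS
    · exact PosSemidef.zero
  normalized := by
    change (if MeasurableSet Set.univ then F.averageOp Set.univ else 0) = 1
    rw [if_pos MeasurableSet.univ]
    ext j k
    simp [averageOp, (F.T _).normalized]

lemma average_apply (F : Observable N E3) {S : Set E3} (hS : MeasurableSet S) :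
    F.average.toVectorMeasure S = F.averageOp S :=
  if_pos hS

/-- Substitute `g ↦ h g`, using left invariance of Haar measure; the factors `U_h` then cancel and
`h` remains only in the preimage of `S`. -/
lemma average_isCovariant (F : Observable N E3) : F.average.IsCovariant := by
  intro h S hS
  have hS' : MeasurableSet (rot h ⁻¹' S) := (rot h).continuous.measurable hS
  rw [average_apply _ hS, average_apply _ hS']
  ext j k
  rw [mul_averageOp_mul_apply F hS, ← integral_mul_left_eq_self _ h]
  change _ = ∫ g, (F.T g).toVectorMeasure (rot h ⁻¹' S) j k ∂haarSU2
  refine integral_congr_ae (Filter.Eventually.of_forall fun g => ?_)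
  have hpre : rot (h * g) ⁻¹' S = rot g ⁻¹' (rot h ⁻¹' S) := by
    ext x
    simp only [Set.mem_preimage, rot_mul]
  have hU : (spinRep N (h * g)).1 = (spinRep N h).1 * (spinRep N g).1 := by
    rw [map_mul]; rfl
  have : (spinRep N h).1ᴴ * (F.T (h * g)).toVectorMeasure S * (spinRep N h).1 =
      (F.T g).toVectorMeasure (rot h ⁻¹' S) := by
    rw [T_apply _ _ hS, T_apply _ _ hS', hpre, hU, conjTranspose_mul]
    simp only [Matrix.mul_assoc]
    rw [spinRep_conjTranspose_mul_self, Matrix.mul_one, ← Matrix.mul_assoc,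
      spinRep_conjTranspose_mul_self, Matrix.one_mul]
  exact congrFun (congrFun this j) k

lemma measurable_dist_T (F : Observable N E3) (ρ : State N) :
    Measurable fun g => (F.T g).dist ρ := by
  refine Measure.measurable_of_measurable_coe _ fun S hS => ?_
  simp only [dist_apply _ _ hS]
  exact (F.measurable_trace_mul_T hS ρ.toOp).ennreal_ofReal

lemma dist_average (F : Observable N E3) (ρ : State N) :
    F.average.dist ρ = haarSU2.bind fun g => (F.T g).dist ρ := by
  ext S hS
  rw [Measure.bind_apply hS (F.measurable_dist_T ρ).aemeasurable, dist_apply _ _ hS,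
    average_apply _ hS, re_trace_mul_averageOp F hS]
  simp only [dist_apply _ _ hS]
  have h0 := fun g => (F.T g).re_trace_nonneg ρ S
  refine ofReal_integral_eq_lintegral_ofReal ?_ (Filter.Eventually.of_forall h0)
  refine Integrable.of_bound (F.measurable_trace_mul_T hS ρ.toOp).aestronglyMeasurable 1
    (Filter.Eventually.of_forall fun g => ?_)
  rw [Real.norm_of_nonneg (h0 g)]
  have h1 : (F.T g).dist ρ S ≤ 1 := prob_le_one
  rw [dist_apply _ _ hS] at h1
  exact ENNReal.ofReal_le_one.1 h1

lemma measurable_dist_marginal_T (F : Observable N E3) (e : E3) (ρ : State N) :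
    Measurable fun g => ((F.T g).marginal e).dist ρ := by
  simp only [dist_marginal]
  exact (Measure.measurable_map _ (measurable_inner_left e)).comp (F.measurable_dist_T ρ)

lemma dist_marginal_average (F : Observable N E3) (e : E3) (ρ : State N) :
    (F.average.marginal e).dist ρ = haarSU2.bind fun g => ((F.T g).marginal e).dist ρ := by
  ext S hS
  have hS' := measurable_inner_left e hS
  rw [Measure.bind_apply hS (F.measurable_dist_marginal_T e ρ).aemeasurable, dist_marginal,
    Measure.map_apply (measurable_inner_left e) hS, dist_average,
    Measure.bind_apply hS' (F.measurable_dist_T ρ).aemeasurable]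
  simp only [dist_marginal, Measure.map_apply (measurable_inner_left e) hS]

end Observable

end

section

/-! ### Averaging does not increase the errors -/

variable {N : ℕ} {α : ℝ}

open Observable

lemma edist_inner_zero_le {e : E3} (he : ‖e‖ = 1) (η : E3) :
    edist (inner ℝ e η) (0 : ℝ) ≤ edist η 0 := by
  rw [edist_zero_right, edist_zero_right, ← ofReal_norm, ← ofReal_norm]
  refine ENNReal.ofReal_le_ofReal ?_
  simpa [he] using norm_inner_le_norm (𝕜 := ℝ) e η

/-- The three coordinate directions suffice, because `‖η‖ ≤ |η₁| + |η₂| + |η₃|`. -/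
lemma hasMoments_of_marginal (hα : 1 ≤ α) {F : Observable N E3}
    (h : ∀ e : Metric.sphere (0 : E3) 1, (F.marginal e).HasMoments α) : F.HasMoments α := by
  have hα0 : 0 < α := by linarith
  intro ρ x
  refine (deviation_le_add_edist hα _ x 0).trans_lt
    (ENNReal.add_lt_top.2 ⟨?_, edist_lt_top _ _⟩)
  let b : Fin 3 → E3 := fun i => EuclideanSpace.single i 1
  have hb : ∀ i, b i ∈ Metric.sphere (0 : E3) 1 := fun i => by simp [b]
  have hm : ∀ i, Measurable fun η : E3 => edist (inner ℝ (b i) η) (0 : ℝ) := fun i =>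
    measurable_edist_left.comp (measurable_inner_left (b i))
  have hle : ∀ η : E3, edist η 0 ≤ edist (inner ℝ (b 0) η) (0 : ℝ) +
      (edist (inner ℝ (b 1) η) (0 : ℝ) + edist (inner ℝ (b 2) η) (0 : ℝ)) := fun η => by
    simp only [edist_zero_right, ← ofReal_norm]
    rw [← ENNReal.ofReal_add (norm_nonneg _) (norm_nonneg _),
      ← ENNReal.ofReal_add (norm_nonneg _) (by positivity)]
    refine ENNReal.ofReal_le_ofReal ?_
    have hη : η = ∑ i, η i • b i := by
      ext j
      fin_cases j <;> simp [b, Fin.sum_univ_three]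
    have h1 : ‖η‖ ≤ ∑ i, ‖η i • b i‖ := by
      conv_lhs => rw [hη]
      exact norm_sum_le _ _
    simp only [norm_smul, Fin.sum_univ_three] at h1
    simp only [b, PiLp.norm_single, norm_one, mul_one] at h1
    simp only [b, EuclideanSpace.inner_single_left, map_one, one_mul]
    linarith
  have hfin : ∀ i, (∫⁻ η, edist (inner ℝ (b i) η) (0 : ℝ) ^ α ∂F.dist ρ) ^ (1 / α) < ⊤ := fun i => by
    have := h ⟨b i, hb i⟩ ρ 0
    rwa [deviation, dist_marginal, lintegral_map (measurable_edist_rpow 0)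
      (measurable_inner_left _)] at this
  have h12 := lintegral_rpow_le_add hα (F.dist ρ) (hm 1) (hm 2) fun η => le_rfl
  have h0 := lintegral_rpow_le_add hα (F.dist ρ) (hm 0) ((hm 1).add (hm 2)) hle
  exact h0.trans_lt (ENNReal.add_lt_top.2 ⟨hfin 0, h12.trans_lt
    (ENNReal.add_lt_top.2 ⟨hfin 1, hfin 2⟩)⟩)

lemma deviation_marginal_average_rpow (hα : 0 < α) (F : Observable N E3) (e : E3) (ρ : State N)
    (x : ℝ) : deviation α ((F.average.marginal e).dist ρ) x ^ α =
      ∫⁻ g, deviation α (((F.T g).marginal e).dist ρ) x ^ α ∂haarSU2 := by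
  rw [deviation_rpow hα, dist_marginal_average, Measure.lintegral_bind
    (F.measurable_dist_marginal_T e ρ).aemeasurable (measurable_edist_rpow x).aemeasurable]
  simp only [deviation_rpow hα]

/-- The moments of `T_g F` are bounded uniformly in `g`: every state distribution is dominated by a
fixed multiple of the trace measure, and `|e · η| ≤ ‖η‖` for every rotated direction. -/
lemma hasMoments_average (hα : 1 ≤ α) {F : Observable N E3} (hF : F.HasMoments α)
    (e : Metric.sphere (0 : E3) 1) : (F.average.marginal e).HasMoments α := by
  have hα0 : 0 < α := by linarith
  have he : ‖(e : E3)‖ = 1 := by simp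
  intro ρ x
  refine (deviation_le_add_edist hα _ x 0).trans_lt
    (ENNReal.add_lt_top.2 ⟨?_, edist_lt_top _ _⟩)
  set B : ℝ≥0∞ := (((N : ℝ≥0) + 1 : ℝ≥0) : ℝ≥0∞) * ∫⁻ η, edist η 0 ^ α ∂F.traceMeasure with hB
  have hBtop : B < ⊤ :=
    ENNReal.mul_lt_top ENNReal.coe_lt_top (hF.lintegral_traceMeasure_lt_top hα0 0)
  have hle : ∀ g, deviation α (((F.T g).marginal e).dist ρ) 0 ^ α ≤ B := fun g => by
    rw [deviation_rpow hα0, dist_marginal_T, dist_marginal,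
      lintegral_map (measurable_edist_rpow 0) (measurable_inner_left _)]
    refine (lintegral_mono fun η => ENNReal.rpow_le_rpow (edist_inner_zero_le
      (by rw [norm_rot, he]) η) hα0.le).trans ?_
    refine (lintegral_mono' (F.dist_le_traceMeasure _) le_rfl).trans_eq ?_
    rw [lintegral_smul_measure]
    rfl
  have h1 : deviation α ((F.average.marginal e).dist ρ) 0 ^ α ≤ B := by
    rw [deviation_marginal_average_rpow hα0]
    refine (lintegral_mono hle).trans_eq ?_
    simp
  rw [← ENNReal.le_rpow_inv_iff hα0] at h1
  exact h1.trans_lt (ENNReal.rpow_lt_top_of_nonneg (by positivity) hBtop.ne)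

lemma metricError_le_DMax (F : Observable N E3) (e : Metric.sphere (0 : E3) 1) :
    metricError α (F.marginal e) (spinObservable N e) ≤ DMax α F :=
  le_iSup (fun e : Metric.sphere (0 : E3) 1 =>
    metricError α (F.marginal e) (spinObservable N e)) e

lemma calError_le_ΔMax (F : Observable N E3) (e : Metric.sphere (0 : E3) 1) :
    calError α (F.marginal e) (spinObservable N e) ≤ ΔMax α F :=
  le_iSup (fun e : Metric.sphere (0 : E3) 1 =>
    calError α (F.marginal e) (spinObservable N e)) e

/-- For fixed direction and state, the distribution of the average is a mixture over `g` of
distributions within `DMax α (F.T g) = DMax α F` of the same finitely supported measure. -/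
lemma DMax_average_le (hα : 1 ≤ α) (F : Observable N E3) : DMax α F.average ≤ DMax α F := by
  have hα0 : 0 < α := by linarith
  rcases eq_or_ne (DMax α F) ⊤ with htop | htop
  · rw [htop]; exact le_top
  have hF : F.HasMoments α := hasMoments_of_marginal hα fun e =>
    hasMoments_of_metricError_lt_top hα (spinObservable_hasMoments hα0 e)
      ((metricError_le_DMax F e).trans_lt htop.lt_top)
  have hK : DMax α F ^ α = ((DMax α F ^ α).toNNReal : ℝ≥0∞) :=
    (ENNReal.coe_toNNReal (ENNReal.rpow_lt_top_of_nonneg hα0.le htop).ne).symm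
  refine iSup_le fun e => iSup_le fun ρ => ?_
  have hav := hasMoments_average hα hF e ρ
  rw [← ENNReal.rpow_le_rpow_iff hα0, hK]
  have hprob : IsProbabilityMeasure (haarSU2.bind fun g => ((F.T g).marginal e).dist ρ) := by
    rw [← dist_marginal_average]
    infer_instance
  rw [dist_marginal_average] at hav ⊢
  refine wasserstein_bind_rpow_le hα0 haarSU2 (F.measurable_dist_marginal_T e ρ) _ _
    (spinObservable_dist_compl (e : E3) ρ) hav _ fun g => ?_
  rw [← hK]
  refine ENNReal.rpow_le_rpow ?_ hα0.le
  rw [← DMax_T α g F]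
  exact (le_iSup (fun ρ => wasserstein α (((F.T g).marginal e).dist ρ)
    ((spinObservable N e).dist ρ)) ρ).trans (metricError_le_DMax (F.T g) e)

/-- A sharp state is admissible for every `ε`, so its deviation under each `T_g F` is already
bounded by `ΔMax α F`; integrating over `g` involves no limit in `ε`. -/
lemma ΔMax_average_le (hα : 1 ≤ α) (F : Observable N E3) : ΔMax α F.average ≤ ΔMax α F := by
  have hα0 : 0 < α := by linarith
  rcases eq_or_ne (ΔMax α F) ⊤ with htop | htop
  · rw [htop]; exact le_top
  have hF : F.HasMoments α := hasMoments_of_marginal hα fun e =>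
    hasMoments_of_calError_lt_top hα (spinObservable_hasMoments hα0 e) (exists_sharp α hα0 e)
      ((calError_le_ΔMax F e).trans_lt htop.lt_top)
  refine iSup_le fun e => calError_le_of_sharp hα (hasMoments_average hα hF e)
    (spinObservable_hasMoments hα0 e) fun ρ x hx => ?_
  rw [← ENNReal.rpow_le_rpow_iff hα0, deviation_marginal_average_rpow hα0]
  refine (lintegral_mono (g := fun _ => ΔMax α F ^ α) fun g => ?_).trans_eq (by simp)
  refine ENNReal.rpow_le_rpow ?_ hα0.le
  rw [← ΔMax_T α g F]
  refine le_trans (le_iInf₂ fun ε _ => ?_) (calError_le_ΔMax (F.T g) e)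
  exact deviation_le_calErrorAt (by rw [hx]; exact zero_le)

lemma iInf_eq_iInf_covariant {Φ : Observable N E3 → ℝ≥0∞} (h : ∀ F, Φ F.average ≤ Φ F) :
    ⨅ F, Φ F = ⨅ F : {F : Observable N E3 // F.IsCovariant}, Φ F.1 :=
  le_antisymm (le_iInf fun F => iInf_le _ F.1)
    (le_iInf fun F => (iInf_le _ (⟨F.average, F.average_isCovariant⟩ :
      {F : Observable N E3 // F.IsCovariant})).trans (h F))

end

end AngularMomentum

end

theorem mainTheorem8 (N : ℕ) (α : ℝ) (hα : 1 ≤ α) :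
    (∀ (g : SU2) (F : Observable N E3),
      DMax α (F.T g) = DMax α F ∧ ΔMax α (F.T g) = ΔMax α F) ∧
    (∀ (a b : ℝ≥0) (hab : a + b = 1) (F G : Observable N E3),
      DMax α (Observable.mix a b hab F G) ^ α ≤ a * DMax α F ^ α + b * DMax α G ^ α ∧
      ΔMax α (Observable.mix a b hab F G) ^ α ≤ a * ΔMax α F ^ α + b * ΔMax α G ^ α) ∧
    (⨅ F : Observable N E3, DMax α F) =
      (⨅ F : {F : Observable N E3 // F.IsCovariant}, DMax α F.1) ∧
    (⨅ F : Observable N E3, ΔMax α F) =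
      (⨅ F : {F : Observable N E3 // F.IsCovariant}, ΔMax α F.1) := by
  have hα0 : 0 < α := by linarith
  exact ⟨fun g F => ⟨DMax_T α g F, ΔMax_T α g F⟩,
    fun a b hab F G => ⟨DMax_mix_rpow_le hα0 a b hab F G, ΔMax_mix_rpow_le hα0 a b hab F G⟩,
    iInf_eq_iInf_covariant (DMax_average_le hα), iInf_eq_iInf_covariant (ΔMax_average_le hα)⟩
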